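/- Let $k$ be an infinite field. A simplicial complex on a finite (ordered) ground set $V$ is a downward closed family of subsets of $V$ (possibly void; $\{\emptyset\}$ is a different complex). Let $\Psi=(\Delta,\Gamma)$ be a relative simplicial complex, i.e. a simplicial complex $\Delta$ with a subcomplex $\Gamma$; its faces are the elements of $\Delta\setminus\Gamma$, and $\dim\tau=|\tau|-1$. For $\tau\in\Delta$ let $\mathrm{st}_\tau\Psi=(\mathrm{st}_\tau\Delta,\mathrm{st}_\tau\Gamma)$, where $\mathrm{st}_\tau\Sigma=\{\rho\in\Sigma\mid\tau\cup\rho\in\Sigma\}$. Let $I_\Sigma\subset k[x_v]$ be the ideal generated by the monomials $\prod_{v\in\sigma}x_v$ with $\sigma\notin\Sigma$, let $k[\Delta]=k[x_v]/I_\Delta$ be the face ring, and let $k[\Psi]=I_\Gamma/I_\Delta$ be the relative face module, both graded by monomial degree. A graded module $M$ over a graded $k$-algebra $A$ is Cohen–Macaulay if some $M$-regular sequence is a homogeneous system of parameters, i.e. a sequence of homogeneous elements of positive degree, of minimal length among such sequences, modulo which $M$ is finite dimensional over $k$; a relative complex is Cohen–Macaulay if its face module is. Suppose that $\Psi$ has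 a face and is pure of dimension $d$ (all its maximal faces have dimension $d$), and that $\mathrm{st}_\tau\Psi$ is Cohen–Macaulay for every nonempty $\tau\in\Delta$ for which $\mathrm{st}_\tau\Psi$ has a face. Let $\Theta=(\theta_1,\dots,\theta_{d+1})$ be a sequence of elements of $k[\Delta]_1$ (any sequence; in particular a generic one). Let $P^*=P^*(\Psi)$ be the partition complex: $P^i=\bigoplus_{\tau\in\Delta,\ \dim\tau=i}k[\mathrm{st}_\tau\Psi]$ for $i\ge-1$ (so $P^{-1}=k[\Psi]$), with differential sending $\alpha$ in the summand of $\rho$ to $\sum_\tau(-1)^{[\tau:\rho]}\alpha$, the sum being over the $\tau=\rho\cup\{v\}\in\Delta$ with $v\notin\rho$, where $[\tau:\rho]$ is the number of elements of $\tau$ that precede $v$ and the term for $\tau$ lies in the summand of $\tau$. Let $K^*=K^*(\Theta)$ be the Koszul complex $K^s=\bigwedge^s\big(\bigoplus_{l=1}^{d+1}k[\Delta]e_l\big)$ with differential $z\mapsto(\sum_l\theta_le_l)\wedge z$. Let $C^{i,s}=P^i\otimes_{k[\Delta]}K^s$, graded so that $m\otimes e_{l_1}\wedge\dots\wedge e_{l_s}$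 has degree $t+d+1-s$ for $m$ homogeneous of degree $t$, and let $\mathrm{Tot}(C)$ be the total complex, $\mathrm{Tot}(C)^m=\bigoplus_{i+s=m}C^{i,s}$, with differential $d^h+(-1)^md^v$. Then for all integers $i,j$ the degree-$j$ part of $H^i(\mathrm{Tot}(C))$ is finite dimensional, and $$\dim_k H^i(\mathrm{Tot}(C))_j=\binom{d+1}{j}\cdot\dim_k H^{i+j-d-1}(\Psi;k),$$ where $\binom{d+1}{j}=0$ for $j<0$, and $H^*(\Psi;k)$ is the simplicial cohomology of the pair $(\Delta,\Gamma)$, with the empty set counted as a cell of dimension $-1$ whenever it is a face of $\Psi$. -/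

import Mathlib

open scoped TensorProduct DirectSum

/-! ### Relative simplicial complexes

A simplicial complex on the ground set `V` is a downwards closed family of finite subsets of `V`,
that is, a `LowerSet (Finset V)`. The void complex `⊥` and the complex `{∅}` are different. -/

/-- A relative simplicial complex `(Δ, Γ)`: a simplicial complex together with a subcomplex. -/
structure RelComplex (V : Type*) where
  Δ : LowerSet (Finset V)
  Γ : LowerSet (Finset V)
  le : Γ ≤ Δ

/-- The star of `τ` in the simplicial complex `Δ`. It is void if `τ` is not a face. -/
def simplicialStar {V : Type*} [DecidableEq V] (Δ : LowerSet (Finset V)) (τ : Finset V) :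
    LowerSet (Finset V) where
  carrier := {ρ | ρ ∈ Δ ∧ τ ∪ ρ ∈ Δ}
  lower' := fun _ _ h hρ =>
    ⟨Δ.lower h hρ.1, Δ.lower (Finset.union_subset_union_right h) hρ.2⟩

theorem simplicialStar_mono {V : Type*} [DecidableEq V] {Γ Δ : LowerSet (Finset V)} (h : Γ ≤ Δ)
    (τ : Finset V) : simplicialStar Γ τ ≤ simplicialStar Δ τ :=
  fun _ hρ => ⟨h hρ.1, h hρ.2⟩

theorem simplicialStar_anti {V : Type*} [DecidableEq V] (Δ : LowerSet (Finset V))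
    {ρ τ : Finset V} (h : ρ ⊆ τ) : simplicialStar Δ τ ≤ simplicialStar Δ ρ :=
  fun _ hσ => ⟨hσ.1, Δ.lower (Finset.union_subset_union_left h) hσ.2⟩

namespace RelComplex

/-- The star `(st_τ Δ, st_τ Γ)`. -/
def star {V : Type*} [DecidableEq V] (Ψ : RelComplex V) (τ : Finset V) : RelComplex V where
  Δ := simplicialStar Ψ.Δ τ
  Γ := simplicialStar Ψ.Γ τ
  le := simplicialStar_mono Ψ.le τ

/-- The faces of `(Δ, Γ)` are the faces of `Δ` that are not faces of `Γ`. -/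
def faces {V : Type*} (Ψ : RelComplex V) : Set (Finset V) := {τ | τ ∈ Ψ.Δ ∧ τ ∉ Ψ.Γ}

/-- `Ψ` has a face, and all maximal faces of `Ψ` have dimension `d`, i.e. `d + 1` elements. -/
def IsPureOfDim {V : Type*} (Ψ : RelComplex V) (d : ℤ) : Prop :=
  Ψ.faces.Nonempty ∧ ∀ τ : Finset V, Maximal (fun σ => σ ∈ Ψ.faces) τ → (τ.card : ℤ) = d + 1

end RelComplex

/-- The number of elements of `τ` that precede `v`; the incidence sign of `τ.erase v` in `τ` is
`(-1) ^ facePos τ v`. -/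
def facePos {V : Type*} [LinearOrder V] (τ : Finset V) (v : V) : ℕ :=
  (τ.filter (fun w => w < v)).card

/-! ### Relative simplicial cohomology

The empty set is a cell of dimension `-1` whenever it is a face. -/

namespace RelComplex

/-- The faces of dimension `i` of `(Δ, Γ)`. -/
abbrev RelFace {V : Type*} (Ψ : RelComplex V) (i : ℤ) : Type _ :=
  {τ : Finset V // τ ∈ Ψ.faces ∧ (τ.card : ℤ) = i + 1}

open Classical in
/-- The coboundary on simplicial cochains of the pair `(Δ, Γ)`, i.e. on cochains that vanish on
the faces of `Γ`. -/
noncomputable def coboundary (k : Type*) [Field k] {V : Type*} [LinearOrder V]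
    (Ψ : RelComplex V) (i i' : ℤ) : (Ψ.RelFace i → k) →ₗ[k] (Ψ.RelFace i' → k) :=
  LinearMap.pi fun τ => ∑ v ∈ τ.1,
    if h : τ.1.erase v ∈ Ψ.faces ∧ ((τ.1.erase v).card : ℤ) = i + 1 then
      ((-1 : ℤ) ^ facePos τ.1 v) • LinearMap.proj (R := k) (φ := fun _ => k)
        (⟨τ.1.erase v, h⟩ : Ψ.RelFace i)
    else 0

/-- The simplicial cohomology `H^i(Δ, Γ; k)`. -/
abbrev Cohomology (k : Type*) [Field k] {V : Type*} [LinearOrder V]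
    (Ψ : RelComplex V) (i : ℤ) : Type _ :=
  LinearMap.ker (Ψ.coboundary k i (i + 1)) ⧸
    (LinearMap.range (Ψ.coboundary k (i - 1) i)).submoduleOf
      (LinearMap.ker (Ψ.coboundary k i (i + 1)))

end RelComplex

/-! ### Face rings and relative face modules -/

/-- The non-face ideal. All elements of the ground set are used as variables; the variable of an
element that is not a vertex of `Δ` lies in the ideal. -/
noncomputable def nonfaceIdeal (k : Type*) [Field k] {V : Type*} (Δ : LowerSet (Finset V)) :
    Ideal (MvPolynomial V k) :=
  Ideal.span {p | ∃ σ : Finset V, σ ∉ Δ ∧ p = ∏ v ∈ σ, MvPolynomial.X v}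

theorem nonfaceIdeal_anti (k : Type*) [Field k] {V : Type*} {Γ Δ : LowerSet (Finset V)}
    (h : Γ ≤ Δ) : nonfaceIdeal k Δ ≤ nonfaceIdeal k Γ :=
  Ideal.span_mono fun _ ⟨σ, hσ, hp⟩ => ⟨σ, fun hσ' => hσ (h hσ'), hp⟩

/-- The face ring `k[Δ]`. -/
def FaceRing (k : Type*) [Field k] {V : Type*} (Δ : LowerSet (Finset V)) : Type _ :=
  MvPolynomial V k ⧸ nonfaceIdeal k Δ

noncomputable instance (k : Type*) [Field k] {V : Type*} (Δ : LowerSet (Finset V)) :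
    CommRing (FaceRing k Δ) :=
  inferInstanceAs (CommRing (MvPolynomial V k ⧸ nonfaceIdeal k Δ))

noncomputable instance (k : Type*) [Field k] {V : Type*} (Δ : LowerSet (Finset V)) :
    Algebra k (FaceRing k Δ) :=
  inferInstanceAs (Algebra k (MvPolynomial V k ⧸ nonfaceIdeal k Δ))

/-- The quotient map `k[x_v] → k[Δ]`. -/
noncomputable def FaceRing.mk (k : Type*) [Field k] {V : Type*} (Δ : LowerSet (Finset V)) :
    MvPolynomial V k →ₐ[k] FaceRing k Δ :=
  Ideal.Quotient.mkₐ k (nonfaceIdeal k Δ)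

/-- The graded piece `k[Δ]_t`. -/
noncomputable def faceRingDeg (k : Type*) [Field k] {V : Type*} (Δ : LowerSet (Finset V))
    (t : ℕ) : Submodule k (FaceRing k Δ) :=
  (MvPolynomial.homogeneousSubmodule V k t).map
    (FaceRing.mk k Δ).toLinearMap

/-- The image in `k[Δ]` of the non-face ideal of `Δ'`. -/
noncomputable def faceIdeal (k : Type*) [Field k] {V : Type*} (Δ Δ' : LowerSet (Finset V)) :
    Ideal (FaceRing k Δ) :=
  (nonfaceIdeal k Δ').map (FaceRing.mk k Δ)

theorem faceIdeal_anti (k : Type*) [Field k] {V : Type*} (Δ : LowerSet (Finset V))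
    {Γ' Δ' : LowerSet (Finset V)} (h : Γ' ≤ Δ') : faceIdeal k Δ Δ' ≤ faceIdeal k Δ Γ' :=
  Ideal.map_mono (nonfaceIdeal_anti k h)

/-- For `Ψ = (Δ', Γ')` with `Δ' ≤ Δ`, the relative face module `k[Ψ] = I_{Γ'} / I_{Δ'}`, viewed as
a module over `k[Δ]`. (Both ideals contain `I_Δ`, so the quotient may be formed in `k[Δ]`.) -/
def FaceModule (k : Type*) [Field k] {V : Type*} (Δ : LowerSet (Finset V))
    (Ψ : RelComplex V) : Type _ :=
  faceIdeal k Δ Ψ.Γ ⧸ (faceIdeal k Δ Ψ.Δ).submoduleOf (faceIdeal k Δ Ψ.Γ)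

section FaceModuleInstances

variable (k : Type*) [Field k] {V : Type*} (Δ : LowerSet (Finset V)) (Ψ : RelComplex V)

noncomputable instance : AddCommGroup (FaceModule k Δ Ψ) :=
  inferInstanceAs
    (AddCommGroup (faceIdeal k Δ Ψ.Γ ⧸ (faceIdeal k Δ Ψ.Δ).submoduleOf (faceIdeal k Δ Ψ.Γ)))

noncomputable instance : Module (FaceRing k Δ) (FaceModule k Δ Ψ) :=
  inferInstanceAs (Module (FaceRing k Δ)
    (faceIdeal k Δ Ψ.Γ ⧸ (faceIdeal k Δ Ψ.Δ).submoduleOf (faceIdeal k Δ Ψ.Γ)))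

noncomputable instance : Module k (FaceModule k Δ Ψ) :=
  inferInstanceAs (Module k
    (faceIdeal k Δ Ψ.Γ ⧸ (faceIdeal k Δ Ψ.Δ).submoduleOf (faceIdeal k Δ Ψ.Γ)))

instance : IsScalarTower k (FaceRing k Δ) (FaceModule k Δ Ψ) :=
  inferInstanceAs (IsScalarTower k (FaceRing k Δ)
    (faceIdeal k Δ Ψ.Γ ⧸ (faceIdeal k Δ Ψ.Δ).submoduleOf (faceIdeal k Δ Ψ.Γ)))

end FaceModuleInstances

/-- The quotient map `I_{Γ'} k[Δ] → k[Ψ]`. -/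
noncomputable def FaceModule.mk (k : Type*) [Field k] {V : Type*} (Δ : LowerSet (Finset V))
    (Ψ : RelComplex V) : faceIdeal k Δ Ψ.Γ →ₗ[FaceRing k Δ] FaceModule k Δ Ψ :=
  ((faceIdeal k Δ Ψ.Δ).submoduleOf (faceIdeal k Δ Ψ.Γ)).mkQ

/-- The graded piece `k[Ψ]_t`: the classes that are represented by elements of degree `t`. -/
noncomputable def faceModuleDeg (k : Type*) [Field k] {V : Type*} (Δ : LowerSet (Finset V))
    (Ψ : RelComplex V) (t : ℕ) : Submodule k (FaceModule k Δ Ψ) :=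
  ((faceRingDeg k Δ t).comap ((faceIdeal k Δ Ψ.Γ).subtype.restrictScalars k)).map
    ((FaceModule.mk k Δ Ψ).restrictScalars k)

/-- The natural map `I_{Γ₁} / I_{Δ₁} → I_{Γ₂} / I_{Δ₂}` for `Δ₂ ≤ Δ₁` and `Γ₂ ≤ Γ₁`, induced by the
identity on polynomials. -/
noncomputable def faceModuleMap (k : Type*) [Field k] {V : Type*} (Δ : LowerSet (Finset V))
    (Ψ₁ Ψ₂ : RelComplex V) (hΔ : Ψ₂.Δ ≤ Ψ₁.Δ) (hΓ : Ψ₂.Γ ≤ Ψ₁.Γ) :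
    FaceModule k Δ Ψ₁ →ₗ[FaceRing k Δ] FaceModule k Δ Ψ₂ :=
  Submodule.mapQ ((faceIdeal k Δ Ψ₁.Δ).submoduleOf (faceIdeal k Δ Ψ₁.Γ))
    ((faceIdeal k Δ Ψ₂.Δ).submoduleOf (faceIdeal k Δ Ψ₂.Γ)) (Submodule.inclusion (faceIdeal_anti k Δ hΓ))
    (fun _ hx => faceIdeal_anti k Δ hΔ hx)

/-! ### Cohen-Macaulay modules -/

/-- A sequence of homogeneous elements of positive degree of the graded `k`-algebra `A` modulo
which `M` is finite dimensional. -/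
def IsParameterSequence (k : Type*) [Field k] {A : Type*} [CommRing A] [Algebra k A]
    (𝒜 : ℕ → Submodule k A) (M : Type*) [AddCommGroup M] [Module A M] [Module k M]
    [IsScalarTower k A M] (Θ : List A) : Prop :=
  (∀ θ ∈ Θ, ∃ t : ℕ, 0 < t ∧ θ ∈ 𝒜 t) ∧
    Module.Finite k (M ⧸ (Ideal.ofList Θ • ⊤ : Submodule A M))

/-- A homogeneous system of parameters: such a sequence of minimal length. -/
def IsHomogeneousSystemOfParameters (k : Type*) [Field k] {A : Type*} [CommRing A] [Algebra k A]
    (𝒜 : ℕ → Submodule k A) (M : Type*) [AddCommGroup M] [Module A M] [Module k M]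
    [IsScalarTower k A M] (Θ : List A) : Prop :=
  IsParameterSequence k 𝒜 M Θ ∧
    ∀ Θ' : List A, IsParameterSequence k 𝒜 M Θ' → Θ.length ≤ Θ'.length

/-- `Ψ` is Cohen-Macaulay over `k`: the face module `k[Ψ]`, over the face ring `k[Δ]`, has a
homogeneous system of parameters which is a regular sequence on it. -/
def RelComplex.IsCohenMacaulay (k : Type*) [Field k] {V : Type*} (Ψ : RelComplex V) : Prop :=
  ∃ Θ : List (FaceRing k Ψ.Δ),
    IsHomogeneousSystemOfParameters k (faceRingDeg k Ψ.Δ) (FaceModule k Ψ.Δ Ψ) Θ ∧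
      RingTheory.Sequence.IsRegular (FaceModule k Ψ.Δ Ψ) Θ

/-! ### The partition complex -/

/-- The faces of dimension `i` of a simplicial complex. -/
abbrev SimplicialFace {V : Type*} (Δ : LowerSet (Finset V)) (i : ℤ) : Type _ :=
  {τ : Finset V // τ ∈ Δ ∧ (τ.card : ℤ) = i + 1}

/-- The facet of `τ` opposite to the vertex `v`. -/
def SimplicialFace.erase {V : Type*} [DecidableEq V] {Δ : LowerSet (Finset V)} {i : ℤ}
    (τ : SimplicialFace Δ (i + 1)) (v : τ.1) : SimplicialFace Δ i :=
  ⟨τ.1.erase v.1, Δ.lower (Finset.erase_subset _ _) τ.2.1, by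
    have h := Finset.card_erase_add_one v.2
    have h' := τ.2.2
    omega⟩

/-- The `i`-th module `⨁_{τ ∈ Δ, dim τ = i} k[st_τ Ψ]` of the partition complex. Since `st_∅ Ψ = Ψ`,
for `i = -1` this is `k[Ψ]`. -/
abbrev PartitionModule (k : Type*) [Field k] {V : Type*} [LinearOrder V]
    (Ψ : RelComplex V) (i : ℤ) : Type _ :=
  (τ : SimplicialFace Ψ.Δ i) → FaceModule k Ψ.Δ (Ψ.star τ.1)

/-- The differential of the partition complex. -/
noncomputable def partitionD (k : Type*) [Field k] {V : Type*} [LinearOrder V]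
    (Ψ : RelComplex V) (i : ℤ) :
    PartitionModule k Ψ i →ₗ[FaceRing k Ψ.Δ] PartitionModule k Ψ (i + 1) :=
  LinearMap.pi fun τ => ∑ v : τ.1, ((-1 : ℤ) ^ facePos τ.1 v.1) •
    (faceModuleMap k Ψ.Δ (Ψ.star (τ.erase v).1) (Ψ.star τ.1)
      (simplicialStar_anti Ψ.Δ (Finset.erase_subset _ _))
      (simplicialStar_anti Ψ.Γ (Finset.erase_subset _ _))).comp
    (LinearMap.proj (τ.erase v))

/-- The graded piece of degree `t` of `PartitionModule k Ψ i`. -/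
noncomputable def partitionDeg (k : Type*) [Field k] {V : Type*} [LinearOrder V]
    (Ψ : RelComplex V) (i : ℤ) (t : ℕ) : Submodule k (PartitionModule k Ψ i) :=
  Submodule.pi Set.univ fun τ => faceModuleDeg k Ψ.Δ (Ψ.star τ.1) t

/-! ### The Koszul complex -/

/-- The differential `z ↦ (∑ l, θ_l e_l) ∧ z` of the Koszul complex `K^s = ⋀^s A^n`. -/
noncomputable def koszulD {A : Type*} [CommRing A] {n : ℕ} (Θ : Fin n → A) (s : ℕ) :
    ⋀[A]^s (Fin n → A) →ₗ[A] ⋀[A]^(s + 1) (Fin n → A) :=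
  (LinearMap.mulLeft A (ExteriorAlgebra.ι A Θ)).restrict fun z hz => by
    rw [LinearMap.mulLeft_apply, ExteriorAlgebra.exteriorPower, pow_succ']
    exact Submodule.mul_mem_mul (LinearMap.mem_range_self _ _) hz

/-- The basis element `e_{l_1} ∧ ⋯ ∧ e_{l_s}`, `l_1 < ⋯ < l_s`, of `⋀^s A^n`. -/
noncomputable def koszulBasis (A : Type*) [CommRing A] {n s : ℕ} (l : Fin s ↪o Fin n) :
    ⋀[A]^s (Fin n → A) :=
  exteriorPower.ιMulti A s fun a => Pi.single (l a) 1

/-! ### Total complexes of double complexes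

Double complexes `C^{i,s}` of `A`-modules, `i : ℤ` and `s : ℕ`, with commuting differentials. -/

/-- `Tot(C)^m = ⨁_{i + s = m} C^{i,s}`. -/
abbrev TotModule (C : ℤ → ℕ → Type*) [∀ i s, AddCommGroup (C i s)] (m : ℤ) : Type _ :=
  ⨁ p : {p : ℤ × ℕ // p.1 + (p.2 : ℤ) = m}, C p.1.1 p.1.2

/-- The differential `d^h + (-1)^m d^v` from `Tot(C)^m` to `Tot(C)^m'`, where `m' = m + 1`. -/
noncomputable def totD {A : Type*} [CommRing A] {C : ℤ → ℕ → Type*}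
    [∀ i s, AddCommGroup (C i s)] [∀ i s, Module A (C i s)]
    (dh : ∀ i s, C i s →ₗ[A] C (i + 1) s) (dv : ∀ i s, C i s →ₗ[A] C i (s + 1))
    (m m' : ℤ) (h : m + 1 = m') : TotModule C m →ₗ[A] TotModule C m' :=
  DirectSum.toModule A _ _ fun p =>
    (DirectSum.lof A {p : ℤ × ℕ // p.1 + (p.2 : ℤ) = m'} (fun p => C p.1.1 p.1.2)
        ⟨(p.1.1 + 1, p.1.2), by have := p.2; dsimp only; omega⟩).comp (dh p.1.1 p.1.2) +
    m.negOnePow •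
      (DirectSum.lof A {p : ℤ × ℕ // p.1 + (p.2 : ℤ) = m'} (fun p => C p.1.1 p.1.2)
        ⟨(p.1.1, p.1.2 + 1), by have := p.2; push_cast; omega⟩).comp (dv p.1.1 p.1.2)

/-- The homology `H^m(Tot(C))`. -/
abbrev TotHomology {A : Type*} [CommRing A] {C : ℤ → ℕ → Type*}
    [∀ i s, AddCommGroup (C i s)] [∀ i s, Module A (C i s)]
    (dh : ∀ i s, C i s →ₗ[A] C (i + 1) s) (dv : ∀ i s, C i s →ₗ[A] C i (s + 1))
    (m : ℤ) : Type _ :=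
  LinearMap.ker (totD dh dv m (m + 1) rfl) ⧸
    (LinearMap.range (totD dh dv (m - 1) m (sub_add_cancel m 1))).submoduleOf
      (LinearMap.ker (totD dh dv m (m + 1) rfl))

/-- A graded piece of `Tot(C)^m`: the elements all of whose components lie in the given graded
pieces `G i s` of the modules `C^{i,s}`. -/
def totDeg {k : Type*} [Field k] {C : ℤ → ℕ → Type*}
    [∀ i s, AddCommGroup (C i s)] [∀ i s, Module k (C i s)]
    (G : ∀ i s, Submodule k (C i s)) (m : ℤ) : Submodule k (TotModule C m) :=
  ⨅ p : {p : ℤ × ℕ // p.1 + (p.2 : ℤ) = m},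
    (G p.1.1 p.1.2).comap (DirectSum.component k _ (fun p => C p.1.1 p.1.2) p)

/-- The corresponding graded piece of `H^m(Tot(C))`: the classes of the cycles that lie in the
graded piece of `Tot(C)^m`. -/
noncomputable def totHomologyDeg {k : Type*} [Field k] {A : Type*} [CommRing A] [Algebra k A]
    {C : ℤ → ℕ → Type*} [∀ i s, AddCommGroup (C i s)] [∀ i s, Module A (C i s)]
    [∀ i s, Module k (C i s)] [∀ i s, IsScalarTower k A (C i s)]
    (dh : ∀ i s, C i s →ₗ[A] C (i + 1) s) (dv : ∀ i s, C i s →ₗ[A] C i (s + 1))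
    (G : ∀ i s, Submodule k (C i s)) (m : ℤ) : Submodule k (TotHomology dh dv m) :=
  ((totDeg G m).comap
      ((LinearMap.ker (totD dh dv m (m + 1) rfl)).subtype.restrictScalars k)).map
    (((LinearMap.range (totD dh dv (m - 1) m (sub_add_cancel m 1))).submoduleOf
      (LinearMap.ker (totD dh dv m (m + 1) rfl))).mkQ.restrictScalars k)

/-! ### Tensor products with the Koszul complex -/

/-- `M ⊗ K^s`, where `K^s = ⋀^s A^n`. -/
abbrev KoszulTensor (A : Type*) [CommRing A] (M : Type*) [AddCommGroup M] [Module A M]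
    (n s : ℕ) : Type _ :=
  M ⊗[A] (⋀[A]^s (Fin n → A))

/-- The graded piece of degree `j` of `M ⊗ K^s`, for `M` graded by `ℳ`: for `m` homogeneous of
degree `t`, the element `m ⊗ e_{l_1} ∧ ⋯ ∧ e_{l_s}` has degree `t + n - s`. -/
def koszulTensorDeg {k : Type*} [Field k] (A : Type*) [CommRing A] [Algebra k A]
    {M : Type*} [AddCommGroup M] [Module A M] [Module k M] [IsScalarTower k A M]
    (ℳ : ℕ → Submodule k M) (n s : ℕ) (j : ℤ) : Submodule k (KoszulTensor A M n s) :=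
  Submodule.span k {x | ∃ (t : ℕ) (m : M) (l : Fin s ↪o Fin n),
    (t : ℤ) + n - s = j ∧ m ∈ ℳ t ∧ x = m ⊗ₜ koszulBasis A l}

/-- The graded piece `H^m(Tot(P^*(Ψ) ⊗ K^*(Θ)))_j`, the tensor product being taken over `k[Δ]`. -/
noncomputable def partitionKoszulHomologyDeg (k : Type*) [Field k] {V : Type*} [LinearOrder V]
    (Ψ : RelComplex V) {n : ℕ} (Θ : Fin n → FaceRing k Ψ.Δ) (m j : ℤ) :
    Submodule k (TotHomology
      (C := fun i s => KoszulTensor (FaceRing k Ψ.Δ) (PartitionModule k Ψ i) n s)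
      (fun i _ => LinearMap.rTensor _ (partitionD k Ψ i))
      (fun _ s => LinearMap.lTensor _ (koszulD Θ s)) m) :=
  totHomologyDeg _ _ (fun i s => koszulTensorDeg (FaceRing k Ψ.Δ) (partitionDeg k Ψ i) n s j) m

/-- The binomial coefficient with an integer lower index; it is zero if the index is negative. -/
def intChoose (n : ℕ) (j : ℤ) : ℕ := if 0 ≤ j then n.choose j.toNat else 0

/-! Write `n = d + 1` and fix the degree `j`. Both differentials preserve it, and since `m ⊗ e_L`
has degree `t + n - s`, row `s` of the double complex in degree `j` consists of copies of the
partition complex in the single polynomial degree `t = j + s - n`, one for each basis element of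
`⋀^s`. Three ranges of rows arise.

If `s < n - j`, then `t < 0` and the row is zero. If `s > n - j`, then `t > 0` and the row is exact
(`partitionD_exact`): the partition complex splits by monomials `x^α`, the part of `x^α` consists of
cochains on the `τ` with `τ ∪ supp α` a face of `Ψ`, and as `α ≠ 0` a vertex of `supp α` serves as
the apex of a contracting cone (`sum_cone_eq`). If `s = n - j`, then `t = 0`, only the monomial `1`
occurs, and the row is a sum of `n.choose s` copies of the relative cochain complex of `Ψ`
(`partitionConst_D`, `partitionConst_eq_zero`, `exists_partitionConst_eq`).

So only one row contributes to the homology of the total complex. A staircase argument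
(`exists_totD_eq`, `nonempty_totHomologyDeg_equiv`) identifies the homology in total degree `i` with
that of this row at `i - s = i + j - n`, and `n.choose s = n.choose j` when `0 ≤ j ≤ n`. If `j > n`
every row is exact; if `j < 0` the row `s = n - j` lies above `n`, where `⋀^s` vanishes. -/

/-! ### Monomial coefficients on relative face modules -/

section Monomials

variable {k : Type*} [Field k] {V : Type*}

/-- A monomial ideal is tested monomial by monomial. A generator of a non-face `σ` divides `x^α`
exactly when `σ ⊆ supp α`, and since `Δ` is downward closed such a `σ` exists exactly when `supp α`
is itself a non-face. -/
theorem mem_nonfaceIdeal {Δ : LowerSet (Finset V)} {p : MvPolynomial V k} :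
    p ∈ nonfaceIdeal k Δ ↔ ∀ α : V →₀ ℕ, α.support ∈ Δ → p.coeff α = 0 := by
  classical
  have hgen : {q : MvPolynomial V k | ∃ σ : Finset V, σ ∉ Δ ∧ q = ∏ v ∈ σ, MvPolynomial.X v} =
      (fun s => MvPolynomial.monomial s (1 : k)) ''
        {α | ∃ σ : Finset V, σ ∉ Δ ∧ α = ∑ v ∈ σ, Finsupp.single v 1} := by
    ext q
    constructor
    · rintro ⟨σ, hσ, rfl⟩
      refine ⟨_, ⟨σ, hσ, rfl⟩, ?_⟩
      simp [MvPolynomial.monomial_sum_one, MvPolynomial.X]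
    · rintro ⟨_, ⟨σ, hσ, rfl⟩, rfl⟩
      refine ⟨σ, hσ, ?_⟩
      simp [MvPolynomial.monomial_sum_one, MvPolynomial.X]
  have happ (σ : Finset V) (v : V) :
      (∑ w ∈ σ, Finsupp.single w 1 : V →₀ ℕ) v = if v ∈ σ then 1 else 0 := by
    simp [Finsupp.finsetSum_apply, Finsupp.single_apply]
  rw [nonfaceIdeal, hgen, MvPolynomial.mem_ideal_span_monomial_image]
  constructor
  · intro h α hα
    by_contra hne
    obtain ⟨_, ⟨σ, hσ, rfl⟩, hle⟩ := h α (MvPolynomial.mem_support_iff.2 hne)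
    refine hσ (Δ.lower (fun v hv => ?_) hα)
    have := hle v
    rw [happ, if_pos hv] at this
    exact Finsupp.mem_support_iff.2 (by omega)
  · intro h α hα
    refine ⟨_, ⟨α.support, fun hΔ => MvPolynomial.mem_support_iff.1 hα (h α hΔ), rfl⟩, fun v => ?_⟩
    rw [happ]
    split_ifs with hv
    · exact Nat.one_le_iff_ne_zero.2 (Finsupp.mem_support_iff.1 hv)
    · exact Nat.zero_le _

theorem FaceRing.mk_surjective (Δ : LowerSet (Finset V)) :
    Function.Surjective (FaceRing.mk k Δ) :=
  Ideal.Quotient.mk_surjective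

theorem mk_mem_faceIdeal {Δ Δ' : LowerSet (Finset V)} (h : Δ' ≤ Δ) {p : MvPolynomial V k} :
    FaceRing.mk k Δ p ∈ faceIdeal k Δ Δ' ↔ p ∈ nonfaceIdeal k Δ' := by
  constructor
  · intro hp
    obtain ⟨q, hq, hqp⟩ := (Ideal.mem_map_iff_of_surjective _ (FaceRing.mk_surjective Δ)).1 hp
    have : q - p ∈ nonfaceIdeal k Δ := Ideal.Quotient.eq.1 hqp
    simpa using Ideal.sub_mem _ hq (nonfaceIdeal_anti k h this)
  · exact Ideal.mem_map_of_mem _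

/-- The class in `k[Ψ]` of a polynomial in the non-face ideal of `Γ`. -/
noncomputable def polyClass (Δ : LowerSet (Finset V)) (Ψ : RelComplex V) (p : MvPolynomial V k)
    (hp : p ∈ nonfaceIdeal k Ψ.Γ) : FaceModule k Δ Ψ :=
  FaceModule.mk k Δ Ψ ⟨FaceRing.mk k Δ p, Ideal.mem_map_of_mem _ hp⟩

variable {Δ : LowerSet (Finset V)} {Ψ : RelComplex V}

theorem polyClass_add {p q : MvPolynomial V k} (hp hq) :
    polyClass Δ Ψ p hp + polyClass Δ Ψ q hq = polyClass Δ Ψ (p + q) (Ideal.add_mem _ hp hq) := by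
  rw [polyClass, polyClass, ← map_add, polyClass]
  congr 1

theorem mk_smul_polyClass (q : MvPolynomial V k) {p : MvPolynomial V k} (hp) :
    FaceRing.mk k Δ q • polyClass Δ Ψ p hp = polyClass Δ Ψ (q * p) (Ideal.mul_mem_left _ q hp) := by
  rw [polyClass, ← map_smul, polyClass]
  congr 1

theorem smul_polyClass (c : k) {p : MvPolynomial V k} (hp) :
    c • polyClass Δ Ψ p hp =
      polyClass Δ Ψ (MvPolynomial.C c * p) (Ideal.mul_mem_left _ _ hp) := by
  rw [← mk_smul_polyClass, ← MvPolynomial.algebraMap_eq, AlgHom.commutes, algebraMap_smul]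

theorem exists_polyClass (x : FaceModule k Δ Ψ) :
    ∃ (p : MvPolynomial V k) (hp : _), polyClass Δ Ψ p hp = x := by
  obtain ⟨⟨y, hy⟩, rfl⟩ := Submodule.mkQ_surjective _ x
  obtain ⟨p, hp, rfl⟩ := (Ideal.mem_map_iff_of_surjective _ (FaceRing.mk_surjective Δ)).1 hy
  exact ⟨p, hp, rfl⟩

theorem polyClass_eq_iff (h : Ψ.Δ ≤ Δ) {p q : MvPolynomial V k} (hp hq) :
    polyClass Δ Ψ p hp = polyClass Δ Ψ q hq ↔
      ∀ α : V →₀ ℕ, α.support ∈ Ψ.Δ → p.coeff α = q.coeff α := by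
  have : polyClass Δ Ψ p hp = polyClass Δ Ψ q hq ↔ p - q ∈ nonfaceIdeal k Ψ.Δ := by
    rw [← mk_mem_faceIdeal h, map_sub]
    exact Submodule.Quotient.eq _
  rw [this, mem_nonfaceIdeal]
  simp only [MvPolynomial.coeff_sub, sub_eq_zero]

open Classical in
/-- The coefficient of a monomial in an element of the relative face module; it is zero unless
the support of the monomial is a face. -/
noncomputable def faceModuleCoeff (h : Ψ.Δ ≤ Δ) (α : V →₀ ℕ) : FaceModule k Δ Ψ →ₗ[k] k where
  -- Two representatives may differ in coefficients whose support is outside `Ψ.Δ`; the cutoff to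
  -- `0` there removes the dependence on the choice and makes the map linear.
  toFun x := if α.support ∈ Ψ.Δ then (exists_polyClass x).choose.coeff α else 0
  map_add' x y := by
    split_ifs with hα
    · obtain ⟨hx, hx'⟩ := (exists_polyClass x).choose_spec
      obtain ⟨hy, hy'⟩ := (exists_polyClass y).choose_spec
      obtain ⟨hz, hz'⟩ := (exists_polyClass (x + y)).choose_spec
      rw [← MvPolynomial.coeff_add]
      refine (polyClass_eq_iff h hz (Ideal.add_mem _ hx hy)).1 ?_ α hα
      rw [hz', ← polyClass_add hx hy, hx', hy']
    · simp
  map_smul' c x := by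
    split_ifs with hα
    · obtain ⟨hx, hx'⟩ := (exists_polyClass x).choose_spec
      obtain ⟨hz, hz'⟩ := (exists_polyClass (c • x)).choose_spec
      rw [RingHom.id_apply, smul_eq_mul, ← MvPolynomial.coeff_C_mul]
      refine (polyClass_eq_iff h hz (Ideal.mul_mem_left _ _ hx)).1 ?_ α hα
      rw [hz', ← smul_polyClass c hx, hx']
    · simp

open Classical in
theorem faceModuleCoeff_polyClass (h : Ψ.Δ ≤ Δ) (α : V →₀ ℕ) {p : MvPolynomial V k} (hp) :
    faceModuleCoeff h α (polyClass Δ Ψ p hp) = if α.support ∈ Ψ.Δ then p.coeff α else 0 := by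
  change (if α.support ∈ Ψ.Δ then _ else 0) = _
  split_ifs with hα
  · obtain ⟨hz, hz'⟩ := (exists_polyClass (polyClass Δ Ψ p hp)).choose_spec
    exact (polyClass_eq_iff h hz hp).1 hz' α hα
  · rfl

theorem faceModule_ext (h : Ψ.Δ ≤ Δ) {x y : FaceModule k Δ Ψ}
    (hxy : ∀ α, faceModuleCoeff h α x = faceModuleCoeff h α y) : x = y := by
  obtain ⟨p, hp, rfl⟩ := exists_polyClass x
  obtain ⟨q, hq, rfl⟩ := exists_polyClass y
  refine (polyClass_eq_iff h hp hq).2 fun α hα => ?_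
  simpa [faceModuleCoeff_polyClass, hα] using hxy α

/-- Outside `Ψ.Δ` the cutoff applies; on `Ψ.Γ` the representative, being in the non-face ideal of
`Ψ.Γ`, has no such monomial. -/
theorem faceModuleCoeff_eq_zero (h : Ψ.Δ ≤ Δ) {α : V →₀ ℕ} (hα : α.support ∉ Ψ.faces)
    (x : FaceModule k Δ Ψ) : faceModuleCoeff h α x = 0 := by
  obtain ⟨p, hp, rfl⟩ := exists_polyClass x
  rw [faceModuleCoeff_polyClass]
  split_ifs with hΔ
  · exact mem_nonfaceIdeal.1 hp α (by_contra fun hΓ => hα ⟨hΔ, hΓ⟩)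
  · rfl

-- On representatives the map is the identity, so it merely discards the monomials whose support
-- leaves `Ψ₂.Δ`.
open Classical in
theorem faceModuleCoeff_map {Ψ₁ Ψ₂ : RelComplex V} (h₁ : Ψ₁.Δ ≤ Δ) (h₂ : Ψ₂.Δ ≤ Δ)
    (hΔ : Ψ₂.Δ ≤ Ψ₁.Δ) (hΓ : Ψ₂.Γ ≤ Ψ₁.Γ) (α : V →₀ ℕ) (x : FaceModule k Δ Ψ₁) :
    faceModuleCoeff h₂ α (faceModuleMap k Δ Ψ₁ Ψ₂ hΔ hΓ x) =
      if α.support ∈ Ψ₂.Δ then faceModuleCoeff h₁ α x else 0 := by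
  obtain ⟨p, hp, rfl⟩ := exists_polyClass x
  have : faceModuleMap k Δ Ψ₁ Ψ₂ hΔ hΓ (polyClass Δ Ψ₁ p hp) =
    polyClass Δ Ψ₂ p (nonfaceIdeal_anti k hΓ hp) := rfl
  rw [this, faceModuleCoeff_polyClass, faceModuleCoeff_polyClass]
  split_ifs with h h'
  · rfl
  · exact absurd (hΔ h) h'
  · rfl

theorem polyClass_mem_faceModuleDeg {p : MvPolynomial V k} (hp) {t : ℕ}
    (ht : p.IsHomogeneous t) : polyClass Δ Ψ p hp ∈ faceModuleDeg k Δ Ψ t :=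
  ⟨⟨FaceRing.mk k Δ p, Ideal.mem_map_of_mem _ hp⟩, ⟨p, ht, rfl⟩, rfl⟩

theorem faceModuleCoeff_of_mem_deg (h : Ψ.Δ ≤ Δ) {t : ℕ} {x : FaceModule k Δ Ψ}
    (hx : x ∈ faceModuleDeg k Δ Ψ t) {α : V →₀ ℕ} (hα : α.degree ≠ t) :
    faceModuleCoeff h α x = 0 := by
  obtain ⟨⟨y, hy⟩, ⟨p, hp, hpy⟩, rfl⟩ := hx
  replace hpy : FaceRing.mk k Δ p = y := hpy
  subst hpy
  by_cases hf : α.support ∈ Ψ.faces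
  · have hpΓ : p ∈ nonfaceIdeal k Ψ.Γ := (mk_mem_faceIdeal (Ψ.le.trans h)).1 hy
    have := faceModuleCoeff_polyClass h α hpΓ
    refine this.trans ?_
    rw [if_pos hf.1]
    exact MvPolynomial.IsHomogeneous.coeff_eq_zero hp hα
  · exact faceModuleCoeff_eq_zero h hf _

/-- Finiteness of `V` leaves finitely many monomials of degree `t`, so prescribed coefficients add
up to a polynomial. With `faceModule_ext`, elements of degree `t` may be treated as functions on the
monomials of degree `t` supported on faces. -/
theorem exists_faceModuleCoeff_eq [Finite V] (h : Ψ.Δ ≤ Δ) (t : ℕ) (f : (V →₀ ℕ) → k)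
    (hf : ∀ α, α.support ∉ Ψ.faces → f α = 0) (ht : ∀ α, α.degree ≠ t → f α = 0) :
    ∃ x ∈ faceModuleDeg k Δ Ψ t, ∀ α, faceModuleCoeff h α x = f α := by
  classical
  have := Fintype.ofFinite V
  have hS : ∀ α : V →₀ ℕ, α ∈ Finset.univ.finsuppAntidiag t ↔ α.degree = t := fun α => by
    simp [Finset.mem_finsuppAntidiag, Finsupp.degree_eq_sum]
  set p : MvPolynomial V k :=
    ∑ α ∈ Finset.univ.finsuppAntidiag t, MvPolynomial.monomial α (f α) with hp
  have hc : ∀ α, p.coeff α = f α := fun α => by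
    rw [hp, MvPolynomial.coeff_sum]
    simp only [MvPolynomial.coeff_monomial, Finset.sum_ite_eq', hS]
    split_ifs with h
    · rfl
    · exact (ht α h).symm
  have hpΓ : p ∈ nonfaceIdeal k Ψ.Γ :=
    mem_nonfaceIdeal.2 fun α hα => (hc α).trans (hf α fun h => h.2 hα)
  refine ⟨polyClass Δ Ψ p hpΓ, polyClass_mem_faceModuleDeg _ ?_, fun α => ?_⟩
  · exact MvPolynomial.IsHomogeneous.sum _ _ _ fun α hα =>
      MvPolynomial.isHomogeneous_monomial _ ((hS α).1 hα)
  · rw [faceModuleCoeff_polyClass, hc]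
    split_ifs with hα
    · rfl
    · exact (hf α fun h => hα h.1).symm

theorem faceModule_smul_mem_deg {t : ℕ} {θ : FaceRing k Δ} (hθ : θ ∈ faceRingDeg k Δ 1)
    {x : FaceModule k Δ Ψ} (hx : x ∈ faceModuleDeg k Δ Ψ t) :
    θ • x ∈ faceModuleDeg k Δ Ψ (t + 1) := by
  obtain ⟨⟨y, hy⟩, ⟨p, hp, hpy⟩, rfl⟩ := hx
  obtain ⟨q, hq, rfl⟩ := hθ
  refine ⟨FaceRing.mk k Δ q • ⟨y, hy⟩, ⟨q * p, ?_, ?_⟩,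
    map_smul (FaceModule.mk k Δ Ψ) _ _⟩
  · rw [add_comm]
    exact MvPolynomial.IsHomogeneous.mul hq hp
  · refine (map_mul (FaceRing.mk k Δ) q p).trans ?_
    exact congrArg (FaceRing.mk k Δ q * ·) hpy

theorem faceModuleCoeff_zero_smul (h : Ψ.Δ ≤ Δ) {θ : FaceRing k Δ}
    (hθ : θ ∈ faceRingDeg k Δ 1) (x : FaceModule k Δ Ψ) :
    faceModuleCoeff h 0 (θ • x) = 0 := by
  obtain ⟨q, hq, rfl⟩ := hθ
  obtain ⟨p, hp, rfl⟩ := exists_polyClass x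
  have h0 : q.coeff 0 = 0 := MvPolynomial.IsHomogeneous.coeff_eq_zero hq (by simp)
  have : faceModuleCoeff h 0 (FaceRing.mk k Δ q • polyClass Δ Ψ p hp) = 0 := by
    rw [mk_smul_polyClass, faceModuleCoeff_polyClass, ← MvPolynomial.constantCoeff_eq, map_mul,
      MvPolynomial.constantCoeff_eq, h0, zero_mul, ite_self]
  exact this

end Monomials

/-! ### The contracting cone on cochains -/

section Cone

variable {V : Type*} [LinearOrder V]

/-- Exactly one of two positions shifts: if `u < v`, removing `u` lowers the position of `v` by one;
if `v < u`, inserting `v` raises that of `u` by one. Either way one sign is gained. -/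
theorem facePos_insert_erase_sign {R : Type*} [CommRing R] {τ : Finset V} {u v : V} (hu : u ∈ τ)
    (hv : v ∉ τ) :
    (-1 : R) ^ facePos (insert v τ) v * (-1) ^ facePos (insert v τ) u =
      -((-1) ^ facePos τ u * (-1) ^ facePos (insert v (τ.erase u)) v) := by
  have hne : u ≠ v := fun h => hv (h ▸ hu)
  rcases lt_or_gt_of_ne hne with h | h
  · have h1 : facePos (insert v τ) u = facePos τ u := by
      rw [facePos, Finset.filter_insert, if_neg (not_lt.2 h.le), facePos]
    have h2 : facePos (insert v τ) v = facePos (insert v (τ.erase u)) v + 1 := by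
      simp only [facePos, Finset.filter_insert, lt_irrefl, if_false, Finset.filter_erase]
      exact (Finset.card_erase_add_one (Finset.mem_filter.2 ⟨hu, h⟩)).symm
    rw [h1, h2]
    ring
  · have h1 : facePos (insert v τ) u = facePos τ u + 1 := by
      rw [facePos, Finset.filter_insert, if_pos h, Finset.card_insert_of_notMem, facePos]
      exact fun h => hv (Finset.mem_filter.1 h).1
    have h2 : facePos (insert v τ) v = facePos (insert v (τ.erase u)) v := by
      simp only [facePos, Finset.filter_insert, lt_irrefl, if_false, Finset.filter_erase]
      rw [Finset.erase_eq_of_notMem]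
      exact fun h' => (Finset.mem_filter.1 h').2.not_gt h
    rw [h1, h2]
    ring

/-- The cone with apex `v` contracts the cochains on all finite subsets. -/
theorem sum_cone_eq {R : Type*} [CommRing R] (X : Finset V → R) (v : V) (τ : Finset V)
    (hX : v ∉ τ → ∑ u ∈ insert v τ,
      (-1 : R) ^ facePos (insert v τ) u * X ((insert v τ).erase u) = 0) :
    ∑ u ∈ τ, (-1 : R) ^ facePos τ u * (if v ∈ τ.erase u then 0 else
      (-1) ^ facePos (insert v (τ.erase u)) v * X (insert v (τ.erase u))) = X τ := by
  by_cases hv : v ∈ τ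
  · rw [Finset.sum_eq_single_of_mem v hv]
    · rw [if_neg (Finset.notMem_erase v τ), Finset.insert_erase hv, ← mul_assoc, ← pow_add,
        Even.neg_one_pow ⟨_, rfl⟩, one_mul]
    · intro u _ hu
      rw [if_pos (Finset.mem_erase.2 ⟨hu.symm, hv⟩), mul_zero]
  -- With `v ∉ τ`, the cocycle condition at `insert v τ` is solved for `X τ`.
  · have h := hX hv
    rw [Finset.sum_insert hv, Finset.erase_insert hv] at h
    have h' := congrArg ((-1 : R) ^ facePos (insert v τ) v * ·) h
    simp only [mul_add, mul_zero, ← mul_assoc, ← pow_add, Even.neg_one_pow ⟨_, rfl⟩, one_mul,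
      Finset.mul_sum] at h'
    rw [eq_neg_of_add_eq_zero_left h', ← Finset.sum_neg_distrib]
    refine Finset.sum_congr rfl fun u hu => ?_
    have hne : u ≠ v := fun h => hv (h ▸ hu)
    rw [if_neg fun h => hv (Finset.mem_of_mem_erase h), pow_add,
      facePos_insert_erase_sign hu hv, Finset.erase_insert_of_ne hne.symm]
    ring

end Cone

/-! ### The partition complex, one monomial at a time -/

section Partition

variable {k : Type*} [Field k] {V : Type*} [LinearOrder V] {Ψ : RelComplex V}

theorem star_le (Ψ : RelComplex V) (τ : Finset V) : (Ψ.star τ).Δ ≤ Ψ.Δ := fun _ h => h.1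

theorem mem_star_faces {τ σ : Finset V} : σ ∈ (Ψ.star τ).faces ↔ τ ∪ σ ∈ Ψ.faces := by
  constructor
  · rintro ⟨h, h'⟩
    exact ⟨h.2, fun hΓ => h' ⟨Ψ.Γ.lower Finset.subset_union_right hΓ, hΓ⟩⟩
  · rintro ⟨h, h'⟩
    exact ⟨⟨Ψ.Δ.lower Finset.subset_union_right h, h⟩, fun hΓ => h' hΓ.2⟩

open Classical in
/-- The coefficients of a fixed monomial in the components of an element of the partition
complex, as a cochain on all finite subsets. -/
noncomputable def partitionCoeff {i : ℤ} (x : PartitionModule k Ψ i) (α : V →₀ ℕ)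
    (σ : Finset V) : k :=
  if h : σ ∈ Ψ.Δ ∧ (σ.card : ℤ) = i + 1 then
    faceModuleCoeff (star_le Ψ σ) α (x ⟨σ, h⟩) else 0

theorem partitionCoeff_coe {i : ℤ} (x : PartitionModule k Ψ i) (α : V →₀ ℕ)
    (τ : SimplicialFace Ψ.Δ i) :
    partitionCoeff x α τ.1 = faceModuleCoeff (star_le Ψ τ.1) α (x τ) :=
  dif_pos τ.2

theorem partitionCoeff_eq_zero {i : ℤ} (x : PartitionModule k Ψ i) {α : V →₀ ℕ} {σ : Finset V}
    (h : σ ∪ α.support ∉ Ψ.faces) : partitionCoeff x α σ = 0 := by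
  rw [partitionCoeff]
  split_ifs
  · exact faceModuleCoeff_eq_zero _ (fun h' => h (mem_star_faces.1 h')) _
  · rfl

theorem partition_ext {i : ℤ} {x y : PartitionModule k Ψ i}
    (h : ∀ (τ : SimplicialFace Ψ.Δ i) (α : V →₀ ℕ), τ.1 ∪ α.support ∈ Ψ.faces →
      partitionCoeff x α τ.1 = partitionCoeff y α τ.1) : x = y := by
  funext τ
  refine faceModule_ext (star_le Ψ τ.1) fun α => ?_
  rw [← partitionCoeff_coe, ← partitionCoeff_coe]
  by_cases hα : τ.1 ∪ α.support ∈ Ψ.faces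
  · exact h τ α hα
  · rw [partitionCoeff_eq_zero _ hα, partitionCoeff_eq_zero _ hα]

/-- The hypothesis puts `α.support` in the star of `τ`, so every restriction map into the summand of
`τ` keeps the coefficient of `x^α`; what remains is the simplicial coboundary in `τ`. -/
theorem partitionCoeff_D {i : ℤ} (x : PartitionModule k Ψ i) (α : V →₀ ℕ)
    (τ : SimplicialFace Ψ.Δ (i + 1)) (h : τ.1 ∪ α.support ∈ Ψ.Δ) :
    partitionCoeff (partitionD k Ψ i x) α τ.1 =
      ∑ v ∈ τ.1, (-1) ^ facePos τ.1 v * partitionCoeff x α (τ.1.erase v) := by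
  have hα : α.support ∈ (Ψ.star τ.1).Δ := ⟨Ψ.Δ.lower Finset.subset_union_right h, h⟩
  rw [partitionCoeff_coe, ← Finset.sum_coe_sort]
  simp only [partitionD, LinearMap.pi_apply, LinearMap.sum_apply, map_sum]
  refine Finset.sum_congr rfl fun v _ => ?_
  rw [LinearMap.smul_apply, map_zsmul, LinearMap.comp_apply, LinearMap.proj_apply]
  have hmap := faceModuleCoeff_map (star_le Ψ (τ.erase v).1) (star_le Ψ τ.1)
    (simplicialStar_anti Ψ.Δ (Finset.erase_subset _ _))
    (simplicialStar_anti Ψ.Γ (Finset.erase_subset _ _)) α (x (τ.erase v))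
  rw [if_pos hα, ← partitionCoeff_coe] at hmap
  refine (congrArg (((-1 : ℤ) ^ facePos τ.1 v.1) • ·) hmap).trans ?_
  rw [zsmul_eq_mul]
  simp [SimplicialFace.erase]

theorem partitionCoeff_of_mem_deg {i : ℤ} {t : ℕ} {x : PartitionModule k Ψ i}
    (hx : x ∈ partitionDeg k Ψ i t) {α : V →₀ ℕ} (hα : α.degree ≠ t) (σ : Finset V) :
    partitionCoeff x α σ = 0 := by
  rw [partitionCoeff]
  split_ifs with h
  · exact faceModuleCoeff_of_mem_deg _ (hx ⟨σ, h⟩ trivial) hα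
  · rfl

theorem exists_partitionCoeff_eq [Finite V] (i : ℤ) (t : ℕ) (f : (V →₀ ℕ) → Finset V → k)
    (hf : ∀ α σ, σ ∪ α.support ∉ Ψ.faces → f α σ = 0) (ht : ∀ α σ, α.degree ≠ t → f α σ = 0) :
    ∃ x ∈ partitionDeg k Ψ i t, ∀ α (τ : SimplicialFace Ψ.Δ i),
      partitionCoeff x α τ.1 = f α τ.1 := by
  choose x hx hx' using fun τ : SimplicialFace Ψ.Δ i =>
    exists_faceModuleCoeff_eq (star_le Ψ τ.1) t (fun α => f α τ.1)
      (fun α hα => hf α _ fun h => hα (mem_star_faces.2 h)) (fun α => ht α _)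
  exact ⟨x, fun τ _ => hx τ, fun α τ => (partitionCoeff_coe _ _ _).trans (hx' τ α)⟩

/-- In positive degree the partition complex is exact. -/
theorem partitionD_exact [Finite V] {i : ℤ} {t : ℕ} (ht : 0 < t)
    {x : PartitionModule k Ψ (i + 1)} (hx : x ∈ partitionDeg k Ψ (i + 1) t)
    (hdx : partitionD k Ψ (i + 1) x = 0) :
    ∃ w ∈ partitionDeg k Ψ i t, partitionD k Ψ i w = x := by
  classical
  -- The cone operator, applied separately to each monomial, with the least vertex of its support as
  -- apex; any choice of apex depending on `α` alone would serve. The value for `α = 0` is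
  -- immaterial, since `t > 0`.
  set f : (V →₀ ℕ) → Finset V → k := fun α σ =>
    if h : α.support.Nonempty then
      if α.support.min' h ∈ σ then 0 else
        (-1) ^ facePos (insert (α.support.min' h) σ) (α.support.min' h) *
          partitionCoeff x α (insert (α.support.min' h) σ)
    else 0 with hfdef
  -- Adjoining the apex leaves `σ ∪ α.support` unchanged, so the cone respects the condition that
  -- this union be a face of `Ψ`.
  have hins {α : V →₀ ℕ} {v : V} (hv : v ∈ α.support) (σ : Finset V) :
      insert v σ ∪ α.support = σ ∪ α.support := by
    rw [Finset.insert_union, Finset.insert_eq_self.2 (Finset.mem_union_right _ hv)]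
  have hf (α σ) (h : σ ∪ α.support ∉ Ψ.faces) : f α σ = 0 := by
    simp only [hfdef]
    split_ifs with h1 h2
    · rfl
    · rw [partitionCoeff_eq_zero, mul_zero]
      rwa [hins (Finset.min'_mem _ _)]
    · rfl
  obtain ⟨w, hw, hwf⟩ := exists_partitionCoeff_eq (Ψ := Ψ) i t f hf fun α σ h => by
    simp only [hfdef]
    split_ifs
    · rfl
    · rw [partitionCoeff_of_mem_deg hx h, mul_zero]
    · rfl
  refine ⟨w, hw, partition_ext fun τ α hα => ?_⟩
  by_cases hdeg : α.degree = t
  · have hne : α.support.Nonempty := by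
      rw [Finset.nonempty_iff_ne_empty, Ne, Finsupp.support_eq_empty]
      rintro rfl
      simp at hdeg
      omega
    set v := α.support.min' hne with hv
    have hvα : v ∈ α.support := Finset.min'_mem _ _
    rw [partitionCoeff_D _ _ _ hα.1, ← sum_cone_eq (partitionCoeff x α) v τ.1]
    · refine Finset.sum_congr rfl fun u hu => ?_
      have := hwf α (τ.erase ⟨u, hu⟩)
      simp only [SimplicialFace.erase] at this
      rw [this]
      simp only [hfdef]
      rw [dif_pos hne]
    · intro hvτ
      have hτ : insert v τ.1 ∪ α.support ∈ Ψ.faces := by rwa [hins hvα]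
      have := partitionCoeff_D x α ⟨insert v τ.1, Ψ.Δ.lower Finset.subset_union_left hτ.1, by
        rw [Finset.card_insert_of_notMem hvτ, Nat.cast_add, τ.2.2, Nat.cast_one]⟩ hτ.1
      rw [← this, hdx]
      simp [partitionCoeff]
  · rw [partitionCoeff_of_mem_deg hx hdeg, partitionCoeff_D _ _ _ hα.1]
    exact Finset.sum_eq_zero fun u _ => by rw [partitionCoeff_of_mem_deg hw hdeg, mul_zero]

/-- The constant coefficients of an element of the partition complex form a relative cochain. -/
noncomputable def partitionConst (k : Type*) [Field k] (Ψ : RelComplex V) (i : ℤ) :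
    PartitionModule k Ψ i →ₗ[k] (Ψ.RelFace i → k) :=
  LinearMap.pi fun τ => (faceModuleCoeff (star_le Ψ τ.1) 0).comp
    (LinearMap.proj (⟨τ.1, τ.2.1.1, τ.2.2⟩ : SimplicialFace Ψ.Δ i))

theorem partitionConst_apply {i : ℤ} (x : PartitionModule k Ψ i) (τ : Ψ.RelFace i) :
    partitionConst k Ψ i x τ = partitionCoeff x 0 τ.1 :=
  (partitionCoeff_coe x 0 ⟨τ.1, τ.2.1.1, τ.2.2⟩).symm

/-- For the monomial `1` the support is empty, so the coefficients live on the faces of `Ψ` itself;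
a facet of `τ` lying in `Γ` contributes zero on both sides. -/
theorem partitionConst_D {i : ℤ} (x : PartitionModule k Ψ i) :
    partitionConst k Ψ (i + 1) (partitionD k Ψ i x) =
      Ψ.coboundary k i (i + 1) (partitionConst k Ψ i x) := by
  funext τ
  rw [partitionConst_apply, partitionCoeff_D x 0 ⟨τ.1, τ.2.1.1, τ.2.2⟩ (by simpa using τ.2.1.1),
    RelComplex.coboundary, LinearMap.pi_apply, LinearMap.sum_apply]
  refine Finset.sum_congr rfl fun v hv => ?_
  split_ifs with h
  · rw [LinearMap.smul_apply, LinearMap.proj_apply, partitionConst_apply, zsmul_eq_mul]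
    simp
  · rw [partitionCoeff_eq_zero, mul_zero, LinearMap.zero_apply]
    intro h'
    refine h ⟨by simpa using h', ?_⟩
    have h1 := Finset.card_erase_add_one hv
    have h2 := τ.2.2
    omega

theorem partitionConst_smul {i : ℤ} {θ : FaceRing k Ψ.Δ} (hθ : θ ∈ faceRingDeg k Ψ.Δ 1)
    (x : PartitionModule k Ψ i) : partitionConst k Ψ i (θ • x) = 0 := by
  funext τ
  exact faceModuleCoeff_zero_smul (star_le Ψ τ.1) hθ _

theorem partitionConst_eq_zero {i : ℤ} {x : PartitionModule k Ψ i}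
    (hx : x ∈ partitionDeg k Ψ i 0) (h : partitionConst k Ψ i x = 0) : x = 0 := by
  refine partition_ext fun τ α hα => ?_
  have h0 : partitionCoeff (0 : PartitionModule k Ψ i) α τ.1 = 0 := by simp [partitionCoeff]
  rw [h0]
  by_cases hdeg : α.degree = 0
  · obtain rfl := (Finsupp.degree_eq_zero_iff α).1 hdeg
    rw [Finsupp.support_zero, Finset.union_empty] at hα
    exact (partitionConst_apply x ⟨τ.1, hα, τ.2.2⟩).symm.trans (congrFun h _)
  · exact partitionCoeff_of_mem_deg hx hdeg _

theorem exists_partitionConst_eq [Finite V] {i : ℤ} (c : Ψ.RelFace i → k) :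
    ∃ x ∈ partitionDeg k Ψ i 0, partitionConst k Ψ i x = c := by
  classical
  obtain ⟨x, hx, h⟩ := exists_partitionCoeff_eq (Ψ := Ψ) i 0 (fun α σ =>
    if h : α = 0 ∧ σ ∈ Ψ.faces ∧ (σ.card : ℤ) = i + 1 then c ⟨σ, h.2⟩ else 0)
    (fun α σ hσ => dif_neg fun h => hσ (by simpa [h.1] using h.2.1))
    (fun α σ hα => dif_neg fun h => hα (by simp [h.1]))
  refine ⟨x, hx, funext fun τ => ?_⟩
  rw [partitionConst_apply, h 0 ⟨τ.1, τ.2.1.1, τ.2.2⟩, dif_pos ⟨rfl, τ.2⟩]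

/-- Homogeneity is detected by coefficients: a homogeneous `y` with the same coefficients as the
image of `x` is built, and extensionality identifies the two. -/
theorem partitionD_mem_deg [Finite V] {i : ℤ} {t : ℕ} {x : PartitionModule k Ψ i}
    (hx : x ∈ partitionDeg k Ψ i t) : partitionD k Ψ i x ∈ partitionDeg k Ψ (i + 1) t := by
  obtain ⟨y, hy, h⟩ := exists_partitionCoeff_eq (Ψ := Ψ) (i + 1) t
    (fun α σ => partitionCoeff (partitionD k Ψ i x) α σ)
    (fun α σ hσ => partitionCoeff_eq_zero _ hσ)
    (fun α σ hα => by
      rw [partitionCoeff]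
      split_ifs with hσ
      · refine (partitionCoeff_coe _ α ⟨σ, hσ⟩).symm.trans ?_
        by_cases hf : σ ∪ α.support ∈ Ψ.faces
        · rw [partitionCoeff_D _ _ ⟨σ, hσ⟩ hf.1]
          exact Finset.sum_eq_zero fun u _ => by rw [partitionCoeff_of_mem_deg hx hα, mul_zero]
        · exact partitionCoeff_eq_zero _ hf
      · rfl)
  rwa [← partition_ext (x := y) fun τ α _ => h α τ]

end Partition

/-! ### Coordinates and degrees on the Koszul factor -/

section Koszul

variable (A : Type*) [CommRing A]

/-- The basis `e_{l_1} ∧ ⋯ ∧ e_{l_s}` of `⋀^s A^n`. -/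
noncomputable def koszulModuleBasis (n s : ℕ) :
    Module.Basis (Fin s ↪o Fin n) A (⋀[A]^s (Fin n → A)) :=
  ((Pi.basisFun A (Fin n)).exteriorPower s).reindex Set.powersetCard.ofFinEmbEquiv.symm

theorem koszulModuleBasis_apply {n s : ℕ} (l : Fin s ↪o Fin n) :
    koszulModuleBasis A n s l = koszulBasis A l := by
  rw [koszulModuleBasis, Module.Basis.reindex_apply, Equiv.symm_symm, exteriorPower.basis_apply,
    exteriorPower.ιMulti_family, Equiv.symm_apply_apply, koszulBasis]
  congr 1
  funext a
  simp

/-- The coordinates of an element of `M ⊗ ⋀^s A^n`. -/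
noncomputable def koszulCoord (M : Type*) [AddCommGroup M] [Module A M] (n s : ℕ) :
    KoszulTensor A M n s ≃ₗ[A] ((Fin s ↪o Fin n) → M) :=
  TensorProduct.equivFinsuppOfBasisRight (koszulModuleBasis A n s) ≪≫ₗ
    Finsupp.linearEquivFunOnFinite A M _

variable {A} {M N : Type*} [AddCommGroup M] [Module A M] [AddCommGroup N] [Module A N] {n s : ℕ}

theorem koszulCoord_tmul (m : M) (z : ⋀[A]^s (Fin n → A)) (l : Fin s ↪o Fin n) :
    koszulCoord A M n s (m ⊗ₜ z) l = (koszulModuleBasis A n s).repr z l • m :=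
  TensorProduct.equivFinsuppOfBasisRight_apply_tmul_apply _ _ _ _

theorem koszulCoord_tmul_koszulBasis (m : M) (l : Fin s ↪o Fin n) :
    koszulCoord A M n s (m ⊗ₜ koszulBasis A l) = Pi.single l m := by
  funext l'
  rw [koszulCoord_tmul, ← koszulModuleBasis_apply, Module.Basis.repr_self, Finsupp.single_apply,
    Pi.single_apply]
  rcases eq_or_ne l l' with rfl | h
  · simp
  · simp [h, h.symm]

/-- This makes each row of the double complex a direct sum of copies of the partition complex. -/
theorem koszulCoord_rTensor (f : M →ₗ[A] N) (x : KoszulTensor A M n s) (l : Fin s ↪o Fin n) :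
    koszulCoord A N n s (f.rTensor _ x) l = f (koszulCoord A M n s x l) := by
  induction x using TensorProduct.induction_on with
  | zero => simp
  | tmul m z => rw [LinearMap.rTensor_tmul, koszulCoord_tmul, koszulCoord_tmul, map_smul]
  | add x y hx hy => simp only [map_add, Pi.add_apply, hx, hy]

theorem koszulCoord_symm (f : (Fin s ↪o Fin n) → M) :
    (koszulCoord A M n s).symm f = ∑ l, f l ⊗ₜ koszulBasis A l := by
  rw [LinearEquiv.symm_apply_eq, map_sum]
  simp only [koszulCoord_tmul_koszulBasis]
  exact (Finset.univ_sum_single f).symm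

theorem lTensor_koszulD (Θ : Fin n → A) (x : KoszulTensor A M n s) :
    (koszulD Θ s).lTensor M x =
      ∑ l, Θ l • (koszulD (Pi.single l (1 : A)) s).lTensor M x := by
  have h : koszulD Θ s = ∑ l, Θ l • koszulD (Pi.single l (1 : A)) s := by
    refine LinearMap.ext fun z => Subtype.ext ?_
    have hΘ : Θ = ∑ l, Θ l • Pi.single l (1 : A) := by
      simp only [← Pi.single_smul, smul_eq_mul, mul_one]
      exact (Finset.univ_sum_single Θ).symm
    change ExteriorAlgebra.ι A Θ * z.1 = _
    conv_lhs => rw [hΘ]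
    simp only [map_sum, map_smul, Finset.sum_mul, LinearMap.sum_apply, LinearMap.smul_apply,
      Submodule.coe_sum, Submodule.coe_smul, smul_mul_assoc]
    rfl
  rw [h, ← LinearMap.coe_lTensorHom, map_sum, LinearMap.sum_apply]
  simp only [map_smul, LinearMap.smul_apply]

theorem koszulD_koszulD (Θ : Fin n → A) (s : ℕ) : (koszulD Θ (s + 1)).comp (koszulD Θ s) = 0 := by
  refine LinearMap.ext fun z => Subtype.ext ?_
  change ExteriorAlgebra.ι A Θ * (ExteriorAlgebra.ι A Θ * z.1) = 0
  rw [← mul_assoc, ExteriorAlgebra.ι_sq_zero, zero_mul]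

/-- The coordinate is a determinant of zeros and ones, the indices `l, L 0, L 1, …` being allowed to
repeat or be out of order. Integrality matters because graded pieces are not stable under arbitrary
scalars of `A`. -/
theorem repr_koszulD_single (l : Fin n) (L : Fin s ↪o Fin n) (L' : Fin (s + 1) ↪o Fin n) :
    ∃ c : ℤ, (koszulModuleBasis A n (s + 1)).repr
      (koszulD (Pi.single l (1 : A)) s (koszulBasis A L)) L' = c := by
  classical
  set r : Fin (s + 1) → Fin n := Fin.cons (α := fun _ => Fin n) l L with hr
  have h : koszulD (Pi.single l (1 : A)) s (koszulBasis A L) =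
      exteriorPower.ιMulti A (s + 1) fun a => (Pi.single (r a) 1 : Fin n → A) := by
    refine Subtype.ext ?_
    change ExteriorAlgebra.ι A (Pi.single l 1) *
      ExteriorAlgebra.ιMulti A s (fun a => (Pi.single (L a) 1 : Fin n → A)) =
        ExteriorAlgebra.ιMulti A (s + 1) fun a => (Pi.single (r a) 1 : Fin n → A)
    rw [ExteriorAlgebra.ιMulti_succ_apply]
    rfl
  rw [h, koszulModuleBasis, Module.Basis.repr_reindex_apply, exteriorPower.basis_repr_apply,
    exteriorPower.ιMultiDual_apply_ιMulti, Equiv.symm_symm, Equiv.symm_apply_apply]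
  refine ⟨(Matrix.of fun a b => if L' b = r a then (1 : ℤ) else 0).det, ?_⟩
  refine Eq.trans ?_ (RingHom.map_det (Int.castRingHom A) _).symm
  congr 1
  ext a b
  simp [Pi.single_apply]

variable {k : Type*} [Field k] [Algebra k A] [Module k M] [IsScalarTower k A M]
  {ℳ : ℕ → Submodule k M}

theorem mem_koszulTensorDeg {t : ℕ} {j : ℤ} (h : (t : ℤ) + n - s = j) {x : KoszulTensor A M n s} :
    x ∈ koszulTensorDeg A ℳ n s j ↔ ∀ l, koszulCoord A M n s x l ∈ ℳ t := by
  constructor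
  · intro hx
    induction hx using Submodule.span_induction with
    | mem x hx =>
      obtain ⟨t', m, l, ht', hm, rfl⟩ := hx
      obtain rfl : t' = t := by omega
      intro l'
      rw [koszulCoord_tmul_koszulBasis, Pi.single_apply]
      split_ifs
      · exact hm
      · exact zero_mem _
    | zero => simp
    | add x y _ _ hx hy =>
      intro l
      rw [map_add]
      exact add_mem (hx l) (hy l)
    | smul c x _ hx =>
      intro l
      rw [LinearMapClass.map_smul_of_tower]
      exact Submodule.smul_mem _ _ (hx l)
  · intro hx
    rw [← (koszulCoord A M n s).symm_apply_apply x, koszulCoord_symm]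
    exact sum_mem fun l _ => Submodule.subset_span ⟨t, _, l, h, hx l, rfl⟩

theorem koszulTensorDeg_eq_bot {j : ℤ} (h : j + s < n) : koszulTensorDeg A ℳ n s j = ⊥ := by
  rw [koszulTensorDeg, Submodule.span_eq_bot]
  rintro _ ⟨t, m, l, ht, -⟩
  omega

theorem koszulTensorDeg_eq_bot_of_lt {j : ℤ} (h : n < s) : koszulTensorDeg A ℳ n s j = ⊥ := by
  rw [koszulTensorDeg, Submodule.span_eq_bot]
  rintro _ ⟨t, m, l, ht, -⟩
  exact absurd (Fintype.card_le_of_injective l l.injective) (by simpa using h)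

theorem lTensor_koszulD_mem_deg {Θ : Fin n → A} {j : ℤ}
    (hΘ : ∀ l t, ∀ m ∈ ℳ t, Θ l • m ∈ ℳ (t + 1)) {x : KoszulTensor A M n s}
    (hx : x ∈ koszulTensorDeg A ℳ n s j) :
    (koszulD Θ s).lTensor M x ∈ koszulTensorDeg A ℳ n (s + 1) j := by
  induction hx using Submodule.span_induction with
  | mem x hx =>
    obtain ⟨t, m, l, ht, hm, rfl⟩ := hx
    -- Multiplication by `Θ l` raises `t` by one, which compensates the passage from `s` to `s + 1`.
    rw [mem_koszulTensorDeg (t := t + 1) (by push_cast; omega)]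
    intro L
    rw [lTensor_koszulD, map_sum, Finset.sum_apply]
    refine sum_mem fun l' _ => ?_
    rw [map_smul, Pi.smul_apply, LinearMap.lTensor_tmul, koszulCoord_tmul]
    obtain ⟨c, hc⟩ := repr_koszulD_single (A := A) l' l L
    rw [hc, Int.cast_smul_eq_zsmul]
    exact hΘ _ _ _ (zsmul_mem hm c)
  | zero => simp
  | add x y _ _ hx hy =>
    rw [map_add]
    exact add_mem hx hy
  | smul c x _ hx =>
    rw [LinearMapClass.map_smul_of_tower]
    exact Submodule.smul_mem _ _ hx

end Koszul

/-! ### The staircase argument in the total complex -/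

section Tot

variable {A : Type*} [CommRing A] {C : ℤ → ℕ → Type*}
    [∀ i s, AddCommGroup (C i s)] [∀ i s, Module A (C i s)]
    (dh : ∀ i s, C i s →ₗ[A] C (i + 1) s) (dv : ∀ i s, C i s →ₗ[A] C i (s + 1))

/-- The inclusion of a summand of the total complex. -/
noncomputable def totOf (A : Type*) [CommRing A] (C : ℤ → ℕ → Type*)
    [∀ i s, AddCommGroup (C i s)] [∀ i s, Module A (C i s)] {m : ℤ} (i : ℤ) (s : ℕ)
    (h : i + (s : ℤ) = m) : C i s →ₗ[A] TotModule C m :=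
  DirectSum.lof A {p : ℤ × ℕ // p.1 + (p.2 : ℤ) = m} (fun p => C p.1.1 p.1.2) ⟨(i, s), h⟩

theorem totOf_apply {m i : ℤ} {s : ℕ} (h : i + (s : ℤ) = m) (x : C i s) :
    totOf A C i s h x ⟨(i, s), h⟩ = x :=
  DirectSum.lof_apply _ _ _

theorem totOf_apply_of_ne {m i i' : ℤ} {s s' : ℕ} (h : i + (s : ℤ) = m) (x : C i s)
    (h' : i' + (s' : ℤ) = m) (hs : s' ≠ s) : totOf A C i s h x ⟨(i', s'), h'⟩ = 0 :=
  DFinsupp.single_eq_of_ne fun h => hs (congrArg (fun p => p.1.2) h)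

theorem totD_totOf {m m' : ℤ} (hm : m + 1 = m') {i : ℤ} {s : ℕ} (h : i + (s : ℤ) = m) (x : C i s) :
    totD dh dv m m' hm (totOf A C i s h x) =
      totOf A C (i + 1) s (by omega) (dh i s x) +
        m.negOnePow • totOf A C i (s + 1) (by push_cast; omega) (dv i s x) := by
  rw [totD, totOf, DirectSum.toModule_lof]
  rfl

theorem totD_apply_succ {m m' : ℤ} (hm : m + 1 = m') (z : TotModule C m) {i : ℤ} {s : ℕ}
    (h : i + ((s + 1 : ℕ) : ℤ) = m) (h' : i + 1 + (s : ℤ) = m)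
    (h'' : i + 1 + ((s + 1 : ℕ) : ℤ) = m') :
    totD dh dv m m' hm z (⟨(i + 1, s + 1), h''⟩ : {p : ℤ × ℕ // p.1 + (p.2 : ℤ) = m'}) =
      dh i (s + 1) (z ⟨(i, s + 1), h⟩) +
        m.negOnePow • dv (i + 1) s (z ⟨(i + 1, s), h'⟩) := by
  induction z using DirectSum.induction_on with
  | zero => simp
  | of p x =>
    obtain ⟨⟨a, b⟩, hp⟩ := p
    change totD dh dv m m' hm (totOf A C a b hp x) ⟨(i + 1, s + 1), h''⟩ =
      dh i (s + 1) (totOf A C a b hp x ⟨(i, s + 1), h⟩) +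
        m.negOnePow • dv (i + 1) s (totOf A C a b hp x ⟨(i + 1, s), h'⟩)
    rw [totD_totOf, DirectSum.add_apply]
    change _ + m.negOnePow • (totOf A C a (b + 1) _ (dv a b x) _) = _
    by_cases hb : b = s + 1
    · subst hb
      obtain rfl : a = i := by omega
      rw [totOf_apply, totOf_apply, totOf_apply_of_ne _ _ _ (by omega),
        totOf_apply_of_ne _ _ _ (by omega), map_zero]
    · rw [totOf_apply_of_ne _ _ _ (Ne.symm hb), totOf_apply_of_ne _ _ _ (Ne.symm hb), map_zero]
      by_cases hb' : b = s
      · subst hb'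
        obtain rfl : a = i + 1 := by omega
        rw [totOf_apply, totOf_apply]
      · rw [totOf_apply_of_ne _ _ _ (by omega), totOf_apply_of_ne _ _ _ (by omega), map_zero]
  | add x y hx hy =>
    simp only [map_add, DirectSum.add_apply, hx, hy, smul_add]
    abel

theorem totD_apply_zero {m m' : ℤ} (hm : m + 1 = m') (z : TotModule C m) {i : ℤ}
    (h : i + ((0 : ℕ) : ℤ) = m) (h'' : i + 1 + ((0 : ℕ) : ℤ) = m') :
    totD dh dv m m' hm z (⟨(i + 1, 0), h''⟩ : {p : ℤ × ℕ // p.1 + (p.2 : ℤ) = m'}) =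
      dh i 0 (z ⟨(i, 0), h⟩) := by
  induction z using DirectSum.induction_on with
  | zero => simp
  | of p x =>
    obtain ⟨⟨a, b⟩, hp⟩ := p
    change totD dh dv m m' hm (totOf A C a b hp x) ⟨(i + 1, 0), h''⟩ =
      dh i 0 (totOf A C a b hp x ⟨(i, 0), h⟩)
    rw [totD_totOf, DirectSum.add_apply]
    change _ + m.negOnePow • (totOf A C a (b + 1) _ (dv a b x) _) = _
    rw [totOf_apply_of_ne _ (dv a b x) _ (by omega), smul_zero, add_zero]
    by_cases hb : b = 0
    · subst hb
      obtain rfl : a = i := by omega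
      rw [totOf_apply, totOf_apply]
    · rw [totOf_apply_of_ne _ _ _ (by omega), totOf_apply_of_ne _ _ _ (by omega), map_zero]
  | add x y hx hy =>
    simp only [map_add, DirectSum.add_apply, hx, hy]

/-- If the components in the rows below row `s` vanish, the vertical differential does not
contribute to row `s`. -/
theorem totD_apply_of_lt {m m' : ℤ} (hm : m + 1 = m') (z : TotModule C m) {i : ℤ} {s : ℕ}
    (h : i + (s : ℤ) = m) (h'' : i + 1 + (s : ℤ) = m')
    (hz : ∀ p : {p : ℤ × ℕ // p.1 + (p.2 : ℤ) = m}, p.1.2 < s → z p = 0) :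
    totD dh dv m m' hm z ⟨(i + 1, s), h''⟩ = dh i s (z ⟨(i, s), h⟩) := by
  cases s with
  | zero => exact totD_apply_zero dh dv hm z h h''
  | succ s =>
    rw [totD_apply_succ dh dv hm z h (by push_cast at h; omega),
      hz ⟨(i + 1, s), by push_cast at h; omega⟩ (Nat.lt_succ_self s), map_zero, smul_zero, add_zero]

/-- The mixed terms cancel because the vertical signs in total degrees `m` and `m + 1` are opposite.
Assuming `dh (dh x) = 0` for the one element `x` suffices: wherever this is used, `dh x` is already
known to be a horizontal cycle. -/
theorem totD_totD_totOf (hcomm : ∀ i s x, dh i (s + 1) (dv i s x) = dv (i + 1) s (dh i s x))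
    (hdv : ∀ i s x, dv i (s + 1) (dv i s x) = 0)
    {m m' m'' : ℤ} (hm : m + 1 = m') (hm' : m' + 1 = m'') {i : ℤ} {s : ℕ}
    (h : i + (s : ℤ) = m) {x : C i s} (hx : dh (i + 1) s (dh i s x) = 0) :
    totD dh dv m' m'' hm' (totD dh dv m m' hm (totOf A C i s h x)) = 0 := by
  rw [totD_totOf, map_add, totD_totOf, hx, map_zero, zero_add]
  rw [Units.smul_def m.negOnePow, map_zsmul, totD_totOf, hdv, map_zero, smul_zero, add_zero, hcomm]
  subst hm
  rw [Int.negOnePow_succ]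
  simp [Units.smul_def]

variable {k : Type*} [Field k] [∀ i s, Module k (C i s)]
  {G : ∀ i s, Submodule k (C i s)}

theorem mem_totDeg {m : ℤ} {x : TotModule C m} : x ∈ totDeg G m ↔ ∀ p, x p ∈ G p.1.1 p.1.2 := by
  simp only [totDeg, Submodule.mem_iInf, Submodule.mem_comap]
  rfl

theorem totOf_mem_totDeg {m i : ℤ} {s : ℕ} (h : i + (s : ℤ) = m) {x : C i s} (hx : x ∈ G i s) :
    totOf A C i s h x ∈ totDeg G m := by
  refine mem_totDeg.2 ?_
  rintro ⟨⟨i', s'⟩, h'⟩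
  by_cases hs : s' = s
  · subst hs
    obtain rfl : i' = i := by omega
    rwa [totOf_apply]
  · rw [totOf_apply_of_ne _ _ _ hs]
    exact zero_mem _

/-- If the rows from row `r` on are exact in the given degree, every cycle of that degree supported
in these rows is a boundary. -/
theorem exists_totD_eq (hcomm : ∀ i s x, dh i (s + 1) (dv i s x) = dv (i + 1) s (dh i s x))
    (hdv : ∀ i s x, dv i (s + 1) (dv i s x) = 0)
    (hdvG : ∀ i s, ∀ x ∈ G i s, dv i s x ∈ G i (s + 1)) {n : ℕ}
    (htop : ∀ i s, n < s → G i s = ⊥) {m m' m'' : ℤ} (hm : m + 1 = m') (hm' : m' + 1 = m'') (N : ℕ) :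
    ∀ r : ℕ, n < r + N →
    (∀ i s, r ≤ s → ∀ x ∈ G (i + 1) s, dh (i + 1) s x = 0 → ∃ w ∈ G i s, dh i s w = x) →
    ∀ y ∈ totDeg G m', totD dh dv m' m'' hm' y = 0 →
    (∀ p : {p : ℤ × ℕ // p.1 + (p.2 : ℤ) = m'}, p.1.2 < r → y p = 0) →
    ∃ x ∈ totDeg G m, totD dh dv m m' hm x = y ∧
      ∀ p : {p : ℤ × ℕ // p.1 + (p.2 : ℤ) = m}, p.1.2 < r → x p = 0 := by
  induction N with
  | zero =>
    -- Here `n < r`, so all the rows that may be nonzero lie above `n` and vanish by `htop`.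
    intro r hr _ y hy _ hyr
    have hy0 : y = 0 := DFinsupp.ext fun p => by
      rcases lt_or_ge p.1.2 r with h | h
      · exact hyr p h
      · have := mem_totDeg.1 hy p
        rw [htop _ _ (by omega)] at this
        exact this
    exact ⟨0, zero_mem _, by rw [hy0, map_zero], fun _ _ => rfl⟩
  | succ N ih =>
    intro r hr hex y hy hdy hyr
    obtain ⟨i, hi⟩ : ∃ i : ℤ, i + (r : ℤ) = m := ⟨m - r, by omega⟩
    have hi' : i + 1 + (r : ℤ) = m' := by omega
    have hdh : dh (i + 1) r (y ⟨(i + 1, r), hi'⟩) = 0 := by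
      rw [← totD_apply_of_lt dh dv hm' y hi' (by omega) hyr, hdy]
      rfl
    obtain ⟨w, hw, hwy⟩ := hex i r le_rfl _ (mem_totDeg.1 hy ⟨(i + 1, r), hi'⟩) hdh
    have hDw := totD_totOf dh dv hm hi w
    have hDwG : totD dh dv m m' hm (totOf A C i r hi w) ∈ totDeg G m' := by
      rw [hDw, Units.smul_def]
      refine add_mem (totOf_mem_totDeg _ ?_) (zsmul_mem (totOf_mem_totDeg _ (hdvG _ _ _ hw)) _)
      rw [hwy]
      exact mem_totDeg.1 hy ⟨(i + 1, r), hi'⟩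
    -- Subtracting the total differential of `w` clears row `r` at the cost of a term `dv w` in row
    -- `r + 1`; the remainder is a cycle supported from row `r + 1` on.
    obtain ⟨x, hx, hDx, hxr⟩ := ih (r + 1) (by omega) (fun i s hs => hex i s (by omega))
      (y - totD dh dv m m' hm (totOf A C i r hi w)) (sub_mem hy hDwG) (by
        rw [map_sub, hdy, totD_totD_totOf dh dv hcomm hdv hm hm' hi (by rw [hwy, hdh]), sub_zero])
      (by
        rintro ⟨⟨a, b⟩, hp⟩ hb
        rw [DirectSum.sub_apply, hDw, DirectSum.add_apply, hwy]
        change _ - (_ + m.negOnePow • (totOf A C i (r + 1) _ (dv i r w) _)) = _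
        dsimp only at hb
        rw [totOf_apply_of_ne _ (dv i r w) _ (by omega), smul_zero, add_zero]
        rcases Nat.lt_succ_iff_lt_or_eq.1 hb with h | rfl
        · rw [hyr _ h, totOf_apply_of_ne _ _ _ h.ne, sub_zero]
        · obtain rfl : a = i + 1 := by dsimp only at hp; omega
          rw [totOf_apply, sub_self])
    refine ⟨x + totOf A C i r hi w, add_mem hx (totOf_mem_totDeg _ hw), ?_, ?_⟩
    · rw [map_add, hDx, sub_add_cancel]
    · rintro ⟨⟨a, b⟩, hp⟩ hb
      rw [DirectSum.add_apply, hxr _ (Nat.lt_succ_of_lt hb), totOf_apply_of_ne _ _ _ hb.ne,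
        add_zero]

end Tot

/-! ### Homology concentrated in one row -/

section TotHomology

variable {A : Type*} [CommRing A] {C : ℤ → ℕ → Type*}
    [∀ i s, AddCommGroup (C i s)] [∀ i s, Module A (C i s)]
    (dh : ∀ i s, C i s →ₗ[A] C (i + 1) s) (dv : ∀ i s, C i s →ₗ[A] C i (s + 1))
    {k : Type*} [Field k] [Algebra k A] [∀ i s, Module k (C i s)]
    [∀ i s, IsScalarTower k A (C i s)] {G : ∀ i s, Submodule k (C i s)}

/-- The cycles of the total complex in a graded piece. -/
noncomputable def totCycleDeg (G : ∀ i s, Submodule k (C i s)) (m : ℤ) :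
    Submodule k (TotModule C m) :=
  (LinearMap.ker (totD dh dv m (m + 1) rfl)).restrictScalars k ⊓ totDeg G m

/-- The homology class of a cycle in a graded piece. -/
noncomputable def totCycleClass (G : ∀ i s, Submodule k (C i s)) (m : ℤ) :
    totCycleDeg dh dv G m →ₗ[k] TotHomology dh dv m :=
  (((LinearMap.range (totD dh dv (m - 1) m (sub_add_cancel m 1))).submoduleOf
      (LinearMap.ker (totD dh dv m (m + 1) rfl))).mkQ.restrictScalars k).comp
    (Submodule.inclusion inf_le_left : totCycleDeg dh dv G m →ₗ[k]
      (LinearMap.ker (totD dh dv m (m + 1) rfl)).restrictScalars k)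

theorem range_totCycleClass (m : ℤ) :
    LinearMap.range (totCycleClass dh dv G m) = totHomologyDeg dh dv G m := by
  ext x
  constructor
  · rintro ⟨⟨z, hz, hz'⟩, rfl⟩
    exact ⟨⟨z, hz⟩, hz', rfl⟩
  · rintro ⟨⟨z, hz⟩, hz', rfl⟩
    exact ⟨⟨z, hz, hz'⟩, rfl⟩

/-- The chain `x` need not be homogeneous, since graded pieces of homology are formed modulo all
boundaries. -/
theorem totCycleClass_eq_zero {m : ℤ} {z : totCycleDeg dh dv G m} :
    totCycleClass dh dv G m z = 0 ↔
      ∃ x, totD dh dv (m - 1) m (sub_add_cancel m 1) x = z.1 :=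
  Submodule.Quotient.mk_eq_zero _

theorem totHomologyDeg_eq_bot
    (hcomm : ∀ i s x, dh i (s + 1) (dv i s x) = dv (i + 1) s (dh i s x))
    (hdv : ∀ i s x, dv i (s + 1) (dv i s x) = 0)
    (hdvG : ∀ i s, ∀ x ∈ G i s, dv i s x ∈ G i (s + 1)) {n : ℕ}
    (htop : ∀ i s, n < s → G i s = ⊥)
    (hex : ∀ i s, ∀ x ∈ G (i + 1) s, dh (i + 1) s x = 0 → ∃ w ∈ G i s, dh i s w = x) (m : ℤ) :
    totHomologyDeg dh dv G m = ⊥ := by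
  rw [← range_totCycleClass, LinearMap.range_eq_bot]
  refine LinearMap.ext fun z => (totCycleClass_eq_zero dh dv).2 ?_
  obtain ⟨x, -, hx, -⟩ := exists_totD_eq dh dv hcomm hdv hdvG htop (sub_add_cancel m 1) rfl (n + 1) 0
    (by omega) (fun i s _ => hex i s) z.1 z.2.2 z.2.1 (fun _ h => absurd h (Nat.not_lt_zero _))
  exact ⟨x, hx⟩

/-- If in a given degree the rows below row `s₀` vanish and those above it are exact, then the
homology of the total complex in this degree is that of row `s₀`. -/
theorem nonempty_totHomologyDeg_equiv
    (hcomm : ∀ i s x, dh i (s + 1) (dv i s x) = dv (i + 1) s (dh i s x))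
    (hdv : ∀ i s x, dv i (s + 1) (dv i s x) = 0)
    (hdhG : ∀ i s, ∀ x ∈ G i s, dh i s x ∈ G (i + 1) s)
    (hdvG : ∀ i s, ∀ x ∈ G i s, dv i s x ∈ G i (s + 1)) {n : ℕ}
    (htop : ∀ i s, n < s → G i s = ⊥) {s₀ : ℕ}
    (hbot : ∀ i s, s < s₀ → G i s = ⊥)
    (hex : ∀ i s, s₀ < s → ∀ x ∈ G (i + 1) s, dh (i + 1) s x = 0 → ∃ w ∈ G i s, dh i s w = x)
    {ι : ℕ → Type*} {W : ℤ → Type*} [∀ i, AddCommGroup (W i)] [∀ i, Module k (W i)]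
    (δ : ∀ i i', W i →ₗ[k] W i') (ψ : ∀ i s, C i s →ₗ[k] (ι s → W i))
    (hψh : ∀ i s x l, ψ (i + 1) s (dh i s x) l = δ i (i + 1) (ψ i s x l))
    (hψv : ∀ i s x, ψ i (s + 1) (dv i s x) = 0)
    (hψinj : ∀ i, ∀ x ∈ G i s₀, ψ i s₀ x = 0 → x = 0)
    (hψsurj : ∀ i c, ∃ x ∈ G i s₀, ψ i s₀ x = c)
    {m a i b : ℤ} (hi : i + (s₀ : ℤ) = m) (ha : a + 1 = i) (hb : i + 1 = b) :
    Nonempty (totHomologyDeg dh dv G m ≃ₗ[k] (ι s₀ → LinearMap.ker (δ i b) ⧸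
      (LinearMap.range (δ a i)).submoduleOf (LinearMap.ker (δ i b)))) := by
  subst hb ha
  have hlow {m : ℤ} {z : TotModule C m} (hz : z ∈ totDeg G m)
      (p : {p : ℤ × ℕ // p.1 + (p.2 : ℤ) = m}) (hp : p.1.2 < s₀) : z p = 0 := by
    have := mem_totDeg.1 hz p
    rwa [hbot _ _ hp] at this
  -- As `x` is arbitrary, it may have a component in row `s₀ - 1`; `ψ` kills the vertical
  -- contribution coming from there.
  have hψD (x : TotModule C (m - 1)) (ha : a + (s₀ : ℤ) = m - 1) :
      ψ (a + 1) s₀ (totD dh dv (m - 1) m (sub_add_cancel m 1) x ⟨(a + 1, s₀), hi⟩) =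
        ψ (a + 1) s₀ (dh a s₀ (x ⟨(a, s₀), ha⟩)) := by
    cases s₀ with
    | zero => rw [totD_apply_zero]
    | succ s =>
      rw [totD_apply_succ dh dv _ x ha (by push_cast at ha; omega), map_add, Units.smul_def,
        map_zsmul, hψv, smul_zero, add_zero]
  have hcyc (z : totCycleDeg dh dv G m) : dh (a + 1) s₀ (z.1 ⟨(a + 1, s₀), hi⟩) = 0 := by
    rw [← totD_apply_of_lt dh dv rfl z.1 hi (by omega) (hlow z.2.2), show totD dh dv m _ rfl z.1 = 0
      from z.2.1]
    rfl
  let F : totCycleDeg dh dv G m →ₗ[k] (ι s₀ → LinearMap.ker (δ (a + 1) (a + 1 + 1))) :=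
    LinearMap.pi fun l => LinearMap.codRestrict _
      ((LinearMap.proj l).comp <| (ψ (a + 1) s₀).comp <|
        ((DirectSum.component k _ (fun p : {p : ℤ × ℕ // p.1 + (p.2 : ℤ) = m} => C p.1.1 p.1.2)
          ⟨(a + 1, s₀), hi⟩)).comp (totCycleDeg dh dv G m).subtype) fun z => by
        change δ _ _ (ψ (a + 1) s₀ (z.1 ⟨(a + 1, s₀), hi⟩) l) = 0
        rw [← hψh, hcyc, map_zero]
        rfl
  have hF (z l) : (F z l).1 = ψ (a + 1) s₀ (z.1 ⟨(a + 1, s₀), hi⟩) l := rfl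
  let f : totCycleDeg dh dv G m →ₗ[k] (ι s₀ → LinearMap.ker (δ (a + 1) (a + 1 + 1)) ⧸
      (LinearMap.range (δ a (a + 1))).submoduleOf (LinearMap.ker (δ (a + 1) (a + 1 + 1)))) :=
    LinearMap.pi fun l => (Submodule.mkQ _).comp ((LinearMap.proj l).comp F)
  have hf0 (z) : f z = 0 ↔ ∀ l, ∃ c, δ a (a + 1) c = ψ (a + 1) s₀ (z.1 ⟨(a + 1, s₀), hi⟩) l := by
    rw [funext_iff]
    refine forall_congr' fun l => ?_
    exact Submodule.Quotient.mk_eq_zero _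
  -- A horizontal cycle `x` in row `s₀` has total differential `±dv x` in row `s₀ + 1`. This bounds
  -- some `y` in the rows above `s₀`, so `x - y` is a total cycle with the same component in row
  -- `s₀`.
  have hsurj : Function.Surjective f := by
    intro c
    choose c' hc' using fun l => Submodule.mkQ_surjective _ (c l)
    obtain ⟨x, hx, hxc⟩ := hψsurj (a + 1) fun l => (c' l).1
    have hdx : dh (a + 1) s₀ x = 0 := hψinj _ _ (hdhG _ _ _ hx) <| funext fun l => by
      rw [hψh, hxc]
      exact (c' l).2
    have hD := totD_totOf dh dv (rfl : m + 1 = m + 1) hi x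
    rw [hdx, map_zero, zero_add] at hD
    obtain ⟨y, hy, hDy, hylow⟩ := exists_totD_eq dh dv hcomm hdv hdvG htop (rfl : m + 1 = m + 1)
      (rfl : m + 1 + 1 = m + 1 + 1) (n + 1) (s₀ + 1) (by omega) (fun i s hs => hex i s (by omega))
      (totD dh dv m (m + 1) rfl (totOf A C (a + 1) s₀ hi x))
      (by
        rw [hD, Units.smul_def]
        exact zsmul_mem (totOf_mem_totDeg _ (hdvG _ _ _ hx)) _)
      (totD_totD_totOf dh dv hcomm hdv _ _ _ (by rw [hdx, map_zero]))
      (fun p hp => by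
        rw [hD]
        change m.negOnePow • totOf A C (a + 1) (s₀ + 1) _ _ ⟨(p.1.1, p.1.2), p.2⟩ = 0
        rw [totOf_apply_of_ne _ _ _ hp.ne, smul_zero])
    have hz : totOf A C (a + 1) s₀ hi x - y ∈ totCycleDeg dh dv G m :=
      ⟨by
        change totD dh dv m (m + 1) rfl _ = 0
        rw [map_sub, hDy, sub_self], sub_mem (totOf_mem_totDeg _ hx) hy⟩
    refine ⟨⟨_, hz⟩, funext fun l => ?_⟩
    rw [← hc']
    refine congrArg (Submodule.mkQ _) (Subtype.ext ?_)
    change ψ (a + 1) s₀ ((totOf A C (a + 1) s₀ hi x - y) ⟨(a + 1, s₀), hi⟩) l = _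
    rw [DirectSum.sub_apply, totOf_apply, hylow _ (Nat.lt_succ_self s₀), sub_zero, hxc]
  -- If the component of `z` in row `s₀` is a horizontal boundary `dh w`, subtracting the total
  -- differential of `w` leaves a cycle in the exact rows. Conversely, `hψD` turns a bounding chain
  -- into bounding cochains.
  have hker : LinearMap.ker f = LinearMap.ker (totCycleClass dh dv G m) := by
    ext z
    rw [LinearMap.mem_ker, LinearMap.mem_ker, hf0, totCycleClass_eq_zero]
    have ha : a + (s₀ : ℤ) = m - 1 := by omega
    constructor
    · intro h
      choose c hc using h
      obtain ⟨w, hw, hwc⟩ := hψsurj a c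
      have hdw : dh a s₀ w = z.1 ⟨(a + 1, s₀), hi⟩ := by
        refine sub_eq_zero.1 (hψinj _ _ (sub_mem (hdhG _ _ _ hw) (mem_totDeg.1 z.2.2 ⟨(a + 1, s₀), hi⟩)) ?_)
        funext l
        rw [map_sub, Pi.sub_apply, hψh, hwc, hc, sub_self]
        rfl
      have hD := totD_totOf dh dv (sub_add_cancel m 1) ha w
      have hDG : totD dh dv (m - 1) m (sub_add_cancel m 1) (totOf A C a s₀ ha w) ∈ totDeg G m := by
        rw [hD, Units.smul_def]
        exact add_mem (totOf_mem_totDeg _ (hdhG _ _ _ hw))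
          (zsmul_mem (totOf_mem_totDeg _ (hdvG _ _ _ hw)) _)
      obtain ⟨y, -, hDy, -⟩ := exists_totD_eq dh dv hcomm hdv hdvG htop (sub_add_cancel m 1)
        (rfl : m + 1 = m + 1) (n + 1) (s₀ + 1) (by omega) (fun i s hs => hex i s (by omega))
        (z.1 - totD dh dv (m - 1) m (sub_add_cancel m 1) (totOf A C a s₀ ha w))
        (sub_mem z.2.2 hDG)
        (by
          rw [map_sub, totD_totD_totOf dh dv hcomm hdv _ _ _ (by rw [hdw, hcyc]), sub_zero]
          exact z.2.1)
        (by
          rintro ⟨⟨i, s⟩, hp⟩ hs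
          rcases Nat.lt_succ_iff_lt_or_eq.1 hs with h | h
          · exact hlow (sub_mem z.2.2 hDG) _ h
          · dsimp only at h
            subst h
            obtain rfl : i = a + 1 := by dsimp only at hp; omega
            rw [DirectSum.sub_apply, hD, DirectSum.add_apply, totOf_apply, hdw]
            change _ - (_ + (m - 1).negOnePow • (totOf A C a (s + 1) _ (dv a s w) _)) = _
            rw [totOf_apply_of_ne _ (dv a s w) _ (by omega), smul_zero, add_zero, sub_self])
      exact ⟨y + totOf A C a s₀ ha w, by rw [map_add, hDy, sub_add_cancel]⟩
    · rintro ⟨x, hx⟩ l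
      refine ⟨ψ a s₀ (x ⟨(a, s₀), ha⟩) l, ?_⟩
      rw [← hψh, ← hψD x ha, hx]
  -- Both targets are the quotient of the homogeneous cycles by the common kernel.
  exact ⟨(LinearEquiv.ofEq _ _ (range_totCycleClass dh dv m)).symm ≪≫ₗ
    (LinearMap.quotKerEquivRange _).symm ≪≫ₗ Submodule.quotEquivOfEq _ _ hker.symm ≪≫ₗ
    f.quotKerEquivOfSurjective hsurj⟩

end TotHomology

/-! ### Constant coefficients on `P^i ⊗ K^s` and binomial counts -/

section Main

variable {k : Type*} [Field k] {V : Type*} [LinearOrder V]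

/-- The constant coefficients of the coordinates of an element of `P^i ⊗ K^s`. -/
noncomputable def partitionKoszulConst (k : Type*) [Field k] (Ψ : RelComplex V) (n : ℕ) (i : ℤ)
    (s : ℕ) : KoszulTensor (FaceRing k Ψ.Δ) (PartitionModule k Ψ i) n s →ₗ[k]
      ((Fin s ↪o Fin n) → Ψ.RelFace i → k) :=
  LinearMap.pi fun l => (partitionConst k Ψ i).comp
    ((LinearMap.proj l).comp
      ((koszulCoord (FaceRing k Ψ.Δ) (PartitionModule k Ψ i) n s).toLinearMap.restrictScalars k))

theorem partitionKoszulConst_apply {Ψ : RelComplex V} {n : ℕ} {i : ℤ} {s : ℕ} (x) (l) :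
    partitionKoszulConst k Ψ n i s x l =
      partitionConst k Ψ i (koszulCoord (FaceRing k Ψ.Δ) (PartitionModule k Ψ i) n s x l) :=
  rfl

theorem intChoose_sub (n s : ℕ) : intChoose n ((n : ℤ) - s) = n.choose s := by
  rw [intChoose]
  split_ifs with h
  · rw [show ((n : ℤ) - s).toNat = n - s by omega, Nat.choose_symm (by omega)]
  · rw [Nat.choose_eq_zero_of_lt (by omega)]

theorem card_finEmb (s n : ℕ) : Fintype.card (Fin s ↪o Fin n) = n.choose s := by
  rw [Fintype.card_congr Set.powersetCard.ofFinEmbEquiv, ← Nat.card_eq_fintype_card,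
    Set.powersetCard.card, Nat.card_fin]

end Main

/-! ### The rows of the partition-Koszul double complex -/

section Main

variable {k : Type*} [Field k] {V : Type*} [LinearOrder V] {Ψ : RelComplex V} {n : ℕ}

theorem rTensor_partitionD_mem_deg [Finite V] {i j : ℤ} {s : ℕ}
    {x : KoszulTensor (FaceRing k Ψ.Δ) (PartitionModule k Ψ i) n s}
    (hx : x ∈ koszulTensorDeg (FaceRing k Ψ.Δ) (partitionDeg k Ψ i) n s j) :
    (partitionD k Ψ i).rTensor _ x ∈
      koszulTensorDeg (FaceRing k Ψ.Δ) (partitionDeg k Ψ (i + 1)) n s j := by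
  by_cases hs : j + s < n
  · rw [koszulTensorDeg_eq_bot hs, Submodule.mem_bot] at hx
    rw [hx, map_zero]
    exact zero_mem _
  · have ht : ((j + s - n).toNat : ℤ) + n - s = j := by omega
    refine (mem_koszulTensorDeg ht).2 fun l => ?_
    rw [koszulCoord_rTensor]
    exact partitionD_mem_deg ((mem_koszulTensorDeg ht).1 hx l)

theorem rTensor_partitionD_exact [Finite V] {i j : ℤ} {s : ℕ} (hs : (n : ℤ) < j + s)
    {x : KoszulTensor (FaceRing k Ψ.Δ) (PartitionModule k Ψ (i + 1)) n s}
    (hx : x ∈ koszulTensorDeg (FaceRing k Ψ.Δ) (partitionDeg k Ψ (i + 1)) n s j)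
    (hdx : (partitionD k Ψ (i + 1)).rTensor _ x = 0) :
    ∃ w ∈ koszulTensorDeg (FaceRing k Ψ.Δ) (partitionDeg k Ψ i) n s j,
      (partitionD k Ψ i).rTensor _ w = x := by
  have ht : ((j + s - n).toNat : ℤ) + n - s = j := by omega
  have hx' := (mem_koszulTensorDeg ht).1 hx
  choose w hw hwx using fun l => partitionD_exact (by omega) (hx' l) (by
    rw [← koszulCoord_rTensor]
    exact congrFun ((LinearEquiv.map_eq_zero_iff _).2 hdx) l)
  refine ⟨(koszulCoord _ _ n s).symm w, (mem_koszulTensorDeg ht).2 fun l => ?_, ?_⟩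
  · rw [LinearEquiv.apply_symm_apply]
    exact hw l
  · refine (koszulCoord _ _ n s).injective (funext fun l => ?_)
    rw [koszulCoord_rTensor, LinearEquiv.apply_symm_apply, hwx]

theorem partitionKoszulConst_rTensor {i : ℤ} {s : ℕ}
    (x : KoszulTensor (FaceRing k Ψ.Δ) (PartitionModule k Ψ i) n s) (l : Fin s ↪o Fin n) :
    partitionKoszulConst k Ψ n (i + 1) s ((partitionD k Ψ i).rTensor _ x) l =
      Ψ.coboundary k i (i + 1) (partitionKoszulConst k Ψ n i s x l) := by
  rw [partitionKoszulConst_apply, koszulCoord_rTensor, partitionConst_D]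
  rfl

/-- Each component of the vertical differential carries a factor `Θ l` of degree one, which has no
constant term. -/
theorem partitionKoszulConst_lTensor {Θ : Fin n → FaceRing k Ψ.Δ}
    (hΘ : ∀ l, Θ l ∈ faceRingDeg k Ψ.Δ 1) {i : ℤ} {s : ℕ}
    (x : KoszulTensor (FaceRing k Ψ.Δ) (PartitionModule k Ψ i) n s) :
    partitionKoszulConst k Ψ n i (s + 1) ((koszulD Θ s).lTensor _ x) = 0 := by
  funext l
  rw [partitionKoszulConst_apply, lTensor_koszulD, map_sum, Finset.sum_apply, map_sum]
  refine Finset.sum_eq_zero fun l' _ => ?_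
  rw [map_smul, Pi.smul_apply, partitionConst_smul (hΘ l')]

theorem partitionKoszulConst_eq_zero {i j : ℤ} {s : ℕ} (hs : j + s = n)
    {x : KoszulTensor (FaceRing k Ψ.Δ) (PartitionModule k Ψ i) n s}
    (hx : x ∈ koszulTensorDeg (FaceRing k Ψ.Δ) (partitionDeg k Ψ i) n s j)
    (hx0 : partitionKoszulConst k Ψ n i s x = 0) : x = 0 := by
  have h0 : ((0 : ℕ) : ℤ) + n - s = j := by omega
  refine (LinearEquiv.map_eq_zero_iff (koszulCoord _ _ n s)).1 (funext fun l => ?_)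
  exact partitionConst_eq_zero ((mem_koszulTensorDeg h0).1 hx l) (congrFun hx0 l)

theorem exists_partitionKoszulConst_eq [Finite V] {i j : ℤ} {s : ℕ} (hs : j + s = n)
    (c : (Fin s ↪o Fin n) → Ψ.RelFace i → k) :
    ∃ x ∈ koszulTensorDeg (FaceRing k Ψ.Δ) (partitionDeg k Ψ i) n s j,
      partitionKoszulConst k Ψ n i s x = c := by
  have h0 : ((0 : ℕ) : ℤ) + n - s = j := by omega
  choose x hx hxc using fun l => exists_partitionConst_eq (c l)
  refine ⟨(koszulCoord _ _ n s).symm x, (mem_koszulTensorDeg h0).2 fun l => ?_,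
    funext fun l => ?_⟩
  · rw [LinearEquiv.apply_symm_apply]
    exact hx l
  · rw [partitionKoszulConst_apply, LinearEquiv.apply_symm_apply, hxc]

theorem rTensor_lTensor_koszulD (Θ : Fin n → FaceRing k Ψ.Δ) (i : ℤ) (s : ℕ)
    (x : KoszulTensor (FaceRing k Ψ.Δ) (PartitionModule k Ψ i) n s) :
    (partitionD k Ψ i).rTensor _ ((koszulD Θ s).lTensor _ x) =
      (koszulD Θ s).lTensor _ ((partitionD k Ψ i).rTensor _ x) := by
  rw [← LinearMap.comp_apply, ← LinearMap.comp_apply, LinearMap.rTensor_comp_lTensor,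
    LinearMap.lTensor_comp_rTensor]

theorem lTensor_koszulD_lTensor_koszulD {A M : Type*} [CommRing A] [AddCommGroup M] [Module A M]
    (Θ : Fin n → A) (s : ℕ) (x : KoszulTensor A M n s) :
    (koszulD Θ (s + 1)).lTensor M ((koszulD Θ s).lTensor M x) = 0 := by
  rw [← LinearMap.comp_apply, ← LinearMap.lTensor_comp, koszulD_koszulD, LinearMap.lTensor_zero,
    LinearMap.zero_apply]

theorem lTensor_koszulD_mem_partitionDeg {Θ : Fin n → FaceRing k Ψ.Δ}
    (hΘ : ∀ l, Θ l ∈ faceRingDeg k Ψ.Δ 1) {i j : ℤ} {s : ℕ}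
    {x : KoszulTensor (FaceRing k Ψ.Δ) (PartitionModule k Ψ i) n s}
    (hx : x ∈ koszulTensorDeg (FaceRing k Ψ.Δ) (partitionDeg k Ψ i) n s j) :
    (koszulD Θ s).lTensor _ x ∈
      koszulTensorDeg (FaceRing k Ψ.Δ) (partitionDeg k Ψ i) n (s + 1) j :=
  lTensor_koszulD_mem_deg (fun l _ _ (hm : _ ∈ partitionDeg k Ψ i _) τ _ => faceModule_smul_mem_deg (hΘ l) (hm τ trivial)) hx

end Main

/-! ### The graded pieces of the total homology -/

section Main

variable {k : Type*} [Field k] {V : Type*} [LinearOrder V] {Ψ : RelComplex V} {n : ℕ}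

theorem partitionKoszulHomologyDeg_eq_bot [Finite V] {Θ : Fin n → FaceRing k Ψ.Δ}
    (hΘ : ∀ l, Θ l ∈ faceRingDeg k Ψ.Δ 1) (i : ℤ) {j : ℤ} (hj : (n : ℤ) < j) :
    partitionKoszulHomologyDeg k Ψ Θ i j = ⊥ :=
  totHomologyDeg_eq_bot (k := k)
    (C := fun i s => KoszulTensor (FaceRing k Ψ.Δ) (PartitionModule k Ψ i) n s)
    (fun i _ => LinearMap.rTensor _ (partitionD k Ψ i))
    (fun _ s => LinearMap.lTensor _ (koszulD Θ s))
    (G := fun i s => koszulTensorDeg (FaceRing k Ψ.Δ) (partitionDeg k Ψ i) n s j) (n := n)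
    (fun i s => rTensor_lTensor_koszulD Θ i s)
    (fun _ s => lTensor_koszulD_lTensor_koszulD Θ s)
    (fun _ _ _ hx => lTensor_koszulD_mem_partitionDeg hΘ hx)
    (fun _ _ hs => koszulTensorDeg_eq_bot_of_lt hs)
    (fun _ _ _ hx hdx => rTensor_partitionD_exact (by omega) hx hdx) i

/-- The relation `j + s = n` singles out the row with `t = 0`; rows below have `t < 0` and rows
above have `t > 0`. -/
theorem nonempty_partitionKoszulHomologyDeg_equiv [Finite V] {Θ : Fin n → FaceRing k Ψ.Δ}
    (hΘ : ∀ l, Θ l ∈ faceRingDeg k Ψ.Δ 1) {i j c : ℤ} {s : ℕ} (hs : j + s = n) (hc : c + s = i) :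
    Nonempty (partitionKoszulHomologyDeg k Ψ Θ i j ≃ₗ[k]
      ((Fin s ↪o Fin n) → Ψ.Cohomology k c)) :=
  nonempty_totHomologyDeg_equiv (k := k)
    (C := fun i s => KoszulTensor (FaceRing k Ψ.Δ) (PartitionModule k Ψ i) n s)
    (fun i _ => LinearMap.rTensor _ (partitionD k Ψ i))
    (fun _ s => LinearMap.lTensor _ (koszulD Θ s))
    (G := fun i s => koszulTensorDeg (FaceRing k Ψ.Δ) (partitionDeg k Ψ i) n s j) (n := n)
    (fun i s => rTensor_lTensor_koszulD Θ i s)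
    (fun _ s => lTensor_koszulD_lTensor_koszulD Θ s)
    (fun _ _ _ hx => rTensor_partitionD_mem_deg hx)
    (fun _ _ _ hx => lTensor_koszulD_mem_partitionDeg hΘ hx)
    (fun _ _ hs => koszulTensorDeg_eq_bot_of_lt hs)
    (fun _ _ h => koszulTensorDeg_eq_bot (by omega))
    (fun _ _ _ _ hx hdx => rTensor_partitionD_exact (by omega) hx hdx)
    (ι := fun s => Fin s ↪o Fin n) (Ψ.coboundary k) (partitionKoszulConst k Ψ n)
    (fun _ _ => partitionKoszulConst_rTensor)
    (fun _ _ => partitionKoszulConst_lTensor hΘ)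
    (fun _ _ => partitionKoszulConst_eq_zero hs)
    (fun _ => exists_partitionKoszulConst_eq hs)
    hc (sub_add_cancel c 1) rfl

theorem finite_finrank_of_equiv {M W : Type*} [AddCommGroup M] [Module k M] [AddCommGroup W]
    [Module k W] [Module.Finite k W] {N : Submodule k M} {s : ℕ}
    (h : Nonempty (N ≃ₗ[k] ((Fin s ↪o Fin n) → W))) :
    Module.Finite k N ∧ Module.finrank k N = n.choose s * Module.finrank k W := by
  obtain ⟨e⟩ := h
  refine ⟨Module.Finite.equiv e.symm, e.finrank_eq.trans ?_⟩
  rw [Module.finrank_pi_fintype, Finset.sum_const, Finset.card_univ, smul_eq_mul, card_finEmb]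

theorem finite_finrank_of_eq_bot {M : Type*} [AddCommGroup M] [Module k M] {N : Submodule k M}
    (h : N = ⊥) : Module.Finite k N ∧ Module.finrank k N = 0 := by
  subst h
  exact ⟨inferInstance, finrank_bot _ _⟩

/-- Negative `j` falls under the second alternative: then `s = n - j > n` and both binomial
coefficients are zero. -/
theorem intChoose_cases (n : ℕ) (j : ℤ) :
    ((n : ℤ) < j ∧ intChoose n j = 0) ∨ ∃ s : ℕ, j + s = n ∧ intChoose n j = n.choose s := by
  rcases lt_or_ge (n : ℤ) j with hj | hj
  · refine Or.inl ⟨hj, ?_⟩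
    rw [intChoose, if_pos (by omega), Nat.choose_eq_zero_of_lt (by omega)]
  · have hs : j + (n - j).toNat = n := by omega
    exact Or.inr ⟨_, hs, by rw [← intChoose_sub, ← eq_sub_of_add_eq hs]⟩

/-- The degree `j` part of the homology of the total complex, without Cohen-Macaulay or purity
hypotheses. -/
theorem finite_finrank_partitionKoszulHomologyDeg [Finite V] {Θ : Fin n → FaceRing k Ψ.Δ}
    (hΘ : ∀ l, Θ l ∈ faceRingDeg k Ψ.Δ 1) {i j c : ℤ} (hc : c = i + j - n) :
    Module.Finite k (partitionKoszulHomologyDeg k Ψ Θ i j) ∧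
      Module.finrank k (partitionKoszulHomologyDeg k Ψ Θ i j) =
        intChoose n j * Module.finrank k (Ψ.Cohomology k c) :=
  (intChoose_cases n j).elim
    (fun hj =>
      have h := finite_finrank_of_eq_bot
        (partitionKoszulHomologyDeg_eq_bot (k := k) (Ψ := Ψ) hΘ i hj.1)
      ⟨h.1, h.2.trans ((congrArg (· * _) hj.2).trans (zero_mul _)).symm⟩)
    fun hj => hj.elim fun s hs =>
      have h := finite_finrank_of_equiv (nonempty_partitionKoszulHomologyDeg_equiv (k := k) (Ψ := Ψ)
        hΘ hs.1 (show c + s = i from by have := hs.1; omega))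
      ⟨h.1, h.2.trans (congrArg (· * _) hs.2).symm⟩

end Main

theorem mainTheorem7 {k : Type*} [Field k] [Infinite k] {V : Type*} [Fintype V] [LinearOrder V]
    (Ψ : RelComplex V) (d : ℤ) (hpure : Ψ.IsPureOfDim d)
    (hCM : ∀ τ ∈ Ψ.Δ, τ.Nonempty → (Ψ.star τ).faces.Nonempty → (Ψ.star τ).IsCohenMacaulay k)
    (n : ℕ) (hn : (n : ℤ) = d + 1)
    (Θ : Fin n → FaceRing k Ψ.Δ) (hΘ : ∀ l, Θ l ∈ faceRingDeg k Ψ.Δ 1) (i j : ℤ) :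
    Module.Finite k (partitionKoszulHomologyDeg k Ψ Θ i j) ∧
      Module.finrank k (partitionKoszulHomologyDeg k Ψ Θ i j) =
        intChoose n j * Module.finrank k (Ψ.Cohomology k (i + j - d - 1)) :=
  finite_finrank_partitionKoszulHomologyDeg hΘ (by omega)
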